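/- Let $p$ be a prime, let $K$ be a finite extension of $\mathbb{Q}_p$ with absolute ramification index $e=v_K(p)$, and fix an algebraic closure $\Omega$ of $K$. For a finite Galois extension $E/F$ of finite extensions of $\mathbb{Q}_p$ with group $G$, put $G_n=\{\sigma\in G : v_E(\sigma x-x)\ge n+1 \text{ for all } x\in\mathcal{O}_E\}$, and call the largest integer $n>0$ with $G_n=G$, if there is one, the ramification break of $E/F$. Let $L/K$ (with $L\subset\Omega$) be a totally ramified cyclic extension of degree $p$ with ramification break $i$, and let $$h_{L/K}(x)=\begin{cases}x & \text{if } x\le i,\\ px-(p-1)i & \text{if } x>i.\end{cases}$$ Let $j$ and $s$ be positive integers not divisible by $p$ such that - if $s\le i$ then $s\le j$, and if $s>i$ then $i+p^{-1}(s-i)\le j$; - $j\le \dfrac{pe}{p-1}$; - if $i\ne j$ then $s=h_{L/K}(j)$; - if $i=j=s$ then the residue field of $K$ does not have exactly $p$ elements. Then there is a cyclic extension $L'/K$ of degree $p$ (with $L'\subset\Omega$) with ramification break $j$ such that $LL'/L$ is cyclic of degree $p$ with ramification break $s$. -/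

import Mathlib

open Polynomial

/-- The ring of integers `𝒪_E` of an algebraic extension `E` of `ℚ_p`: the integral closure of
`ℤ_p` in `E`. -/
noncomputable abbrev padicRingOfIntegers (p : ℕ) [Fact p.Prime] (E : Type*) [Field E] [Algebra ℚ_[p] E] :
    Subalgebra (PadicInt.subring p) E :=
  integralClosure (PadicInt.subring p) E

/-- Integral elements are exactly those of absolute value at most one, for the unique extension
of the `p`-adic absolute value. -/
theorem mem_padicRingOfIntegers_iff (p : ℕ) [Fact p.Prime] {E : Type*} [Field E]
    [Algebra ℚ_[p] E] [Algebra.IsAlgebraic ℚ_[p] E] (x : E) :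
    x ∈ padicRingOfIntegers p E ↔ spectralNorm ℚ_[p] E x ≤ 1 := by
  have hx : IsIntegral ℚ_[p] x := (Algebra.IsAlgebraic.isAlgebraic x).isIntegral
  constructor
  · rintro ⟨f, hf, hfx⟩
    have hmon : (f.map (algebraMap (PadicInt.subring p) ℚ_[p])).Monic := hf.map _
    have hroot : aeval x (f.map (algebraMap (PadicInt.subring p) ℚ_[p])) = 0 := by
      rw [aeval_map_algebraMap]; exact hfx
    have h1 : spectralAlgNorm ℚ_[p] E x ≤
        spectralValue (f.map (algebraMap (PadicInt.subring p) ℚ_[p])) :=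
      norm_root_le_spectralValue spectralAlgNorm_isPowMul
        (isNonarchimedean_spectralNorm (K := ℚ_[p]) (L := E)) hmon hroot
    refine h1.trans ((spectralValue_le_one_iff hmon).2 fun n => ?_)
    rw [coeff_map]
    exact (f.coeff n).2
  · intro h
    have hc := (spectralValue_le_one_iff (minpoly.monic hx)).1 h
    have hlift : (minpoly ℚ_[p] x) ∈ Polynomial.lifts (algebraMap (PadicInt.subring p) ℚ_[p]) := by
      rw [Polynomial.lifts_iff_coeff_lifts]
      exact fun n => ⟨⟨_, hc n⟩, rfl⟩
    obtain ⟨f, hf, -, hfm⟩ := Polynomial.lifts_and_degree_eq_and_monic hlift (minpoly.monic hx)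
    refine ⟨f, hfm, ?_⟩
    have := minpoly.aeval ℚ_[p] x
    rw [← hf, aeval_map_algebraMap] at this
    exact this

instance padicRingOfIntegers_isLocalRing (p : ℕ) [Fact p.Prime] (E : Type*) [Field E]
    [Algebra ℚ_[p] E] [Algebra.IsAlgebraic ℚ_[p] E] : IsLocalRing (padicRingOfIntegers p E) := by
  have key : ∀ x : padicRingOfIntegers p E,
      IsUnit x ↔ spectralMulAlgNorm ℚ_[p] E (x : E) = 1 := by
    intro x
    have hle : ∀ y : padicRingOfIntegers p E, spectralMulAlgNorm ℚ_[p] E (y : E) ≤ 1 :=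
      fun y => (mem_padicRingOfIntegers_iff p (y : E)).1 y.2
    constructor
    · rintro ⟨u, rfl⟩
      have h1 : spectralMulAlgNorm ℚ_[p] E ((u : padicRingOfIntegers p E) : E) *
          spectralMulAlgNorm ℚ_[p] E ((u⁻¹ : (padicRingOfIntegers p E)ˣ) :
            padicRingOfIntegers p E) = 1 := by
        rw [← map_mul, ← MulMemClass.coe_mul, Units.mul_inv]
        exact map_one _
      have h2 := hle u
      have h3 := hle (u⁻¹ : (padicRingOfIntegers p E)ˣ)
      have h4 : 0 ≤ spectralMulAlgNorm ℚ_[p] E ((u : padicRingOfIntegers p E) : E) :=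
        apply_nonneg _ _
      nlinarith
    · intro h
      have hx0 : (x : E) ≠ 0 := by
        intro h0
        rw [h0, map_zero] at h
        exact zero_ne_one h
      have hinv : (x : E)⁻¹ ∈ padicRingOfIntegers p E := by
        rw [mem_padicRingOfIntegers_iff]
        have h1 : spectralMulAlgNorm ℚ_[p] E (x : E) * spectralMulAlgNorm ℚ_[p] E (x : E)⁻¹ = 1 := by
          rw [← map_mul, mul_inv_cancel₀ hx0]
          exact map_one _
        rw [h, one_mul] at h1
        exact h1.le
      exact IsUnit.of_mul_eq_one (⟨_, hinv⟩ : padicRingOfIntegers p E)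
        (Subtype.ext (mul_inv_cancel₀ hx0))
  refine IsLocalRing.of_nonunits_add fun a b ha hb => ?_
  rw [mem_nonunits_iff, key] at *
  have ha' := lt_of_le_of_ne ((mem_padicRingOfIntegers_iff p (a : E)).1 a.2) ha
  have hb' := lt_of_le_of_ne ((mem_padicRingOfIntegers_iff p (b : E)).1 b.2) hb
  exact ((isNonarchimedean_spectralNorm (K := ℚ_[p]) (L := E) (a : E) (b : E)).trans_lt
    (max_lt ha' hb')).ne

instance intermediateField_isScalarTower_padic (p : ℕ) [Fact p.Prime] {K Ω : Type*} [Field K]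
    [Field Ω] [Algebra ℚ_[p] K] [Algebra ℚ_[p] Ω] [Algebra K Ω]
    [IsScalarTower ℚ_[p] K Ω] (S : IntermediateField K Ω) : IsScalarTower ℚ_[p] S Ω :=
  IsScalarTower.of_algebraMap_eq fun x => IsScalarTower.algebraMap_apply ℚ_[p] K Ω x ▸ rfl

instance intermediateField_isAlgebraic_padic (p : ℕ) [Fact p.Prime] {K Ω : Type*} [Field K]
    [Field Ω] [Algebra ℚ_[p] K] [Algebra ℚ_[p] Ω] [IsAlgClosure ℚ_[p] Ω] [Algebra K Ω]
    [IsScalarTower ℚ_[p] K Ω] (S : IntermediateField K Ω) : Algebra.IsAlgebraic ℚ_[p] S :=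
  have := IsAlgClosure.isAlgebraic (R := ℚ_[p]) (K := Ω)
  Algebra.IsAlgebraic.of_injective (IsScalarTower.toAlgHom ℚ_[p] S Ω)
    (algebraMap S Ω).injective

/-- The absolute ramification index `e = v_E(p)`: the largest `n` with `p ∈ 𝔪_E ^ n`. -/
noncomputable def absRamificationIndex (p : ℕ) [Fact p.Prime] (E : Type*) [Field E]
    [Algebra ℚ_[p] E] [Algebra.IsAlgebraic ℚ_[p] E] : ℕ :=
  sSup {n : ℕ | (p : padicRingOfIntegers p E) ∈
    IsLocalRing.maximalIdeal (padicRingOfIntegers p E) ^ n}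

/-- The `n`-th ramification group in the lower numbering: the automorphisms `σ` of `E / F` that
act trivially on `𝒪_E / 𝔪_E ^ (n + 1)`, that is `v_E (σ x - x) ≥ n + 1` for all `x ∈ 𝒪_E`. -/
def lowerRamificationGroup (p : ℕ) [Fact p.Prime] (F E : Type*) [Field F] [Field E]
    [Algebra ℚ_[p] F] [Algebra ℚ_[p] E] [Algebra F E] [IsScalarTower ℚ_[p] F E]
    [Algebra.IsAlgebraic ℚ_[p] E] (n : ℕ) : Subgroup Gal(E/F) where
  carrier := {σ | ∀ x : padicRingOfIntegers p E,
    ∃ y ∈ IsLocalRing.maximalIdeal (padicRingOfIntegers p E) ^ (n + 1), (y : E) = σ x - x}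
  one_mem' := fun x => ⟨0, zero_mem _, by simp⟩
  mul_mem' := by
    intro σ τ hσ hτ x
    have hτx : τ x ∈ padicRingOfIntegers p E :=
      IsIntegral.map ((τ.restrictScalars ℚ_[p]).restrictScalars (PadicInt.subring p)) x.2
    obtain ⟨y, hy, hyx⟩ := hσ ⟨τ x, hτx⟩
    obtain ⟨z, hz, hzx⟩ := hτ x
    refine ⟨y + z, add_mem hy hz, ?_⟩
    push_cast
    rw [hyx, hzx, AlgEquiv.mul_apply]
    ring
  inv_mem' := by
    intro σ hσ x
    have hx : σ⁻¹ (x : E) ∈ padicRingOfIntegers p E :=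
      IsIntegral.map ((σ⁻¹.restrictScalars ℚ_[p]).restrictScalars (PadicInt.subring p)) x.2
    obtain ⟨y, hy, hyx⟩ := hσ ⟨σ⁻¹ x, hx⟩
    refine ⟨-y, neg_mem hy, ?_⟩
    have h1 : σ (σ⁻¹ (x : E)) = x := by rw [← AlgEquiv.mul_apply, mul_inv_cancel]; rfl
    push_cast
    rw [hyx]
    simp only [h1]
    ring

/-- `n` is the ramification break of `E / F`: the largest positive `x` with `G = G_x`.
(The lower numbering jumps only at integers, so integral indices suffice.) If such an `n` exists
then `G = G_0`, so `E / F` is totally ramified when it is Galois. -/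
def IsRamificationBreak (p : ℕ) [Fact p.Prime] (F E : Type*) [Field F] [Field E]
    [Algebra ℚ_[p] F] [Algebra ℚ_[p] E] [Algebra F E] [IsScalarTower ℚ_[p] F E]
    [Algebra.IsAlgebraic ℚ_[p] E] (n : ℕ) : Prop :=
  IsGreatest {m : ℕ | 0 < m ∧ lowerRamificationGroup p F E m = ⊤} n

/-- `E / F` is a cyclic Galois extension of degree `d`. -/
structure IsCyclicOfDegree (F E : Type*) [Field F] [Field E] [Algebra F E] (d : ℕ) : Prop where
  isGalois : IsGalois F E
  isCyclic : IsCyclic Gal(E/F)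
  finrank_eq : Module.finrank F E = d

/-- The Herbrand function `h_{L/K}` of a totally ramified cyclic extension of degree `p` with
ramification break `i`. -/
noncomputable def herbrandFunction (p i : ℕ) (x : ℝ) : ℝ :=
  if x ≤ i then x else p * x - (p - 1) * i

/-! The field `L'` is generated by a root `α` of an Artin–Schreier equation `X ^ p - X = a` with `a
∈ K`. In characteristic zero this still works when the pole is moderate, `|p| |α| ^ (p - 1) < 1`;
for `a` of pole order `j` this means `j < pe / (p - 1)`. The cross terms of `(α + y) ^ p` are then
smaller than `y`, so distinct roots differ by units congruent to elements of `𝔽_p`, and a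
Krasner-type argument puts all roots in `F(α)`. If some `b ∈ F` makes `α - b` of pole order `s / p`
in the valuation of `F`, with `p ∤ s`, then `F(α) / F` is cyclic of degree `p` with break `s`
(`isCyclicOfDegree_and_isRamificationBreak_of_artinSchreier`). Over `K` take `b = 0`. Over `L`, `γ =
α - b` nearly satisfies the equation of `c = a - b ^ p + b`, so it suffices to find `a ∈ K` and `b ∈
L` with `v_L(b) = -j` and `v_L(c) = -s` (`exists_extension_of_reduction`).

To control `c`, take `σ ∈ Gal(L/K)` outside `G_{i+1}`. The size of `σ z - z` is `r ^ i` times the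
distance from `z` to `K` (`exists_abv_sub_eq`). Since `σ (b ^ p) - b ^ p` is close to `(σ b - b) ^
p`, the best approximation of `b ^ p` in `K` has an error of valuation `-pj + (p - 1)i` if `(p - 1)i
< pe`. For `j < i` an error smaller than `b` is available, and `s = j`. For `j > i` the error
dominates, and `s = pj - (p - 1)i`. For `j = i` the two tie: `s = i` requires a residue class `w`
with `w ^ p ≠ w` to avoid cancellation, while `s < i` is reached by forcing cancellation and
correcting one order at a time. -/

/-! ### Ultrametric estimates and `p`-th powers. -/

section Nonarchimedean

variable {L : Type*} [Field L] {N : AbsoluteValue L ℝ}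

theorem IsNonarchimedean.abv_add_le (hN : IsNonarchimedean N) {x y : L} {c : ℝ} (hx : N x ≤ c)
    (hy : N y ≤ c) : N (x + y) ≤ c :=
  (hN x y).trans (max_le hx hy)

theorem IsNonarchimedean.abv_sub_le (hN : IsNonarchimedean N) {x y : L} {c : ℝ} (hx : N x ≤ c)
    (hy : N y ≤ c) : N (x - y) ≤ c := by
  rw [sub_eq_add_neg]
  exact hN.abv_add_le hx (by rwa [N.map_neg])

theorem IsNonarchimedean.abv_add_lt (hN : IsNonarchimedean N) {x y : L} {c : ℝ} (hx : N x < c)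
    (hy : N y < c) : N (x + y) < c :=
  (hN x y).trans_lt (max_lt hx hy)

theorem IsNonarchimedean.abv_sub_lt (hN : IsNonarchimedean N) {x y : L} {c : ℝ} (hx : N x < c)
    (hy : N y < c) : N (x - y) < c := by
  rw [sub_eq_add_neg]
  exact hN.abv_add_lt hx (by rwa [N.map_neg])

theorem IsNonarchimedean.abv_sum_le (hN : IsNonarchimedean N) {ι : Type*} {s : Finset ι}
    {f : ι → L} {c : ℝ} (hc : 0 ≤ c) (h : ∀ k ∈ s, N (f k) ≤ c) : N (∑ k ∈ s, f k) ≤ c :=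
  Finset.sum_induction f (fun x => N x ≤ c) (fun _ _ => hN.abv_add_le) (by simpa using hc) h

theorem IsNonarchimedean.abv_eq_of_sub_lt (hN : IsNonarchimedean N) {x y : L}
    (h : N (x - y) < N y) : N x = N y := by
  have := hN.add_eq_right_of_lt h
  rwa [sub_add_cancel] at this

/-- The binomial expansion of a `p`-th power, modulo `p`. -/
theorem IsNonarchimedean.abv_add_pow_prime_sub_le (hN : IsNonarchimedean N) {p : ℕ}
    (hp : p.Prime) {x y : L} (h : N y ≤ N x) :
    N ((x + y) ^ p - x ^ p - y ^ p) ≤ N (p : L) * N x ^ (p - 1) * N y := by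
  have hle : N (∑ k ∈ Finset.Ioo 0 p, x ^ (k - 1) * y ^ (p - k - 1) * ((p.choose k / p : ℕ) : L))
      ≤ N x ^ (p - 2) := by
    refine hN.abv_sum_le (by positivity) fun k hk => ?_
    rw [Finset.mem_Ioo] at hk
    rw [map_mul, map_mul, map_pow, map_pow]
    calc N x ^ (k - 1) * N y ^ (p - k - 1) * N ((p.choose k / p : ℕ) : L)
        ≤ N x ^ (k - 1) * N x ^ (p - k - 1) * 1 := by
          gcongr
          exact hN.apply_natCast_le_one
      _ = N x ^ (p - 2) := by
          rw [mul_one, ← pow_add]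
          congr 1
          omega
  rw [add_pow_prime_eq hp, show ∀ a b c : L, a + b + c - a - b = c by intros; ring, map_mul,
    map_mul, map_mul]
  calc _ ≤ N (p : L) * N x * N y * N x ^ (p - 2) := by gcongr
    _ = _ := by
      rw [show p - 1 = p - 2 + 1 by have := hp.two_le; omega, pow_succ]
      ring

/-- A sum dominates its terms if the nonzero terms have distinct absolute values. -/
theorem IsNonarchimedean.abv_le_abv_sum (hN : IsNonarchimedean N) {ι : Type*} {s : Finset ι}
    {f : ι → L} (h : ∀ k ∈ s, ∀ l ∈ s, k ≠ l → f k ≠ 0 → N (f k) ≠ N (f l)) :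
    ∀ k ∈ s, N (f k) ≤ N (∑ l ∈ s, f l) := by
  intro k hk
  obtain ⟨m, hm, hmax⟩ := s.exists_max_image (fun k => N (f k)) ⟨k, hk⟩
  rcases eq_or_ne (f m) 0 with h0 | h0
  · exact (hmax k hk).trans (by rw [h0, map_zero]; exact N.nonneg _)
  · rw [IsNonarchimedean.apply_sum_eq_of_lt hN (fun a => (N.map_neg a).symm) hm fun l hl hlm =>
      lt_of_le_of_ne (hmax l hl) (h m hm l hl hlm.symm h0).symm]
    exact hmax k hk

end Nonarchimedean

/-! ### Total ramification of degree `p`: orthogonal powers and approximation from `K`. -/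

section PrimeDegree

/-- `L / K` has prime degree `p` and is totally ramified for the discrete nonarchimedean absolute
value `N`, whose value group on `L` is generated by `r`. -/
structure IsTotallyRamifiedOfPrimeDegree (p : ℕ) (K : Type*) {L : Type*} [Field K] [Field L]
    [Algebra K L] (N : AbsoluteValue L ℝ) (r : ℝ) : Prop where
  prime : p.Prime
  nonarch : IsNonarchimedean N
  pos : 0 < r
  lt_one : r < 1
  exists_abv_eq : ∀ x : L, x ≠ 0 → ∃ n : ℤ, N x = r ^ n
  exists_abv_algebraMap_eq : ∀ x : K, x ≠ 0 → ∃ n : ℤ, N (algebraMap K L x) = r ^ (p * n : ℤ)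
  exists_uniformizer : ∃ x : L, N x = r
  finrank_eq : Module.finrank K L = p

variable {p : ℕ} {K L : Type*} [Field K] [Field L] [Algebra K L] {N : AbsoluteValue L ℝ} {r : ℝ}

namespace IsTotallyRamifiedOfPrimeDegree

variable (h : IsTotallyRamifiedOfPrimeDegree p K N r)
include h

theorem zpow_le {m n : ℤ} : r ^ m ≤ r ^ n ↔ n ≤ m :=
  zpow_le_zpow_iff_right_of_lt_one₀ h.pos h.lt_one

theorem zpow_lt {m n : ℤ} : r ^ m < r ^ n ↔ n < m :=
  zpow_lt_zpow_iff_right_of_lt_one₀ h.pos h.lt_one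

theorem zpow_inj {m n : ℤ} (hmn : r ^ m = r ^ n) : m = n :=
  zpow_right_injective₀ h.pos h.lt_one.ne hmn

theorem zpow_add (m n : ℤ) : r ^ (m + n) = r ^ m * r ^ n := zpow_add₀ h.pos.ne' m n

theorem le_of_lt_zpow {x : L} {n : ℤ} (hx : N x < r ^ n) : N x ≤ r ^ (n + 1) := by
  rcases eq_or_ne x 0 with rfl | h0
  · rw [map_zero]
    exact (zpow_pos h.pos _).le
  · obtain ⟨m, hm⟩ := h.exists_abv_eq x h0
    rw [hm, h.zpow_lt] at hx
    rw [hm, h.zpow_le]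
    omega

theorem exists_abv_eq_zpow (n : ℤ) : ∃ x : L, N x = r ^ n := by
  obtain ⟨x, hx⟩ := h.exists_uniformizer
  exact ⟨x ^ n, by rw [map_zpow₀, hx]⟩

theorem abv_algebraMap_ne_zpow {m : ℤ} (hm : ¬ (p : ℤ) ∣ m) (a : K) :
    N (algebraMap K L a) ≠ r ^ m := by
  rcases eq_or_ne a 0 with rfl | h0
  · rw [map_zero, map_zero]
    exact (zpow_pos h.pos _).ne
  · obtain ⟨n, hn⟩ := h.exists_abv_algebraMap_eq a h0
    rw [hn]
    intro e
    exact hm ⟨n, (h.zpow_inj e).symm⟩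

theorem not_dvd_mul {m : ℤ} (hm : ¬ (p : ℤ) ∣ m) {k : ℤ} (hk : 0 < |k|) (hkp : |k| < p) :
    ¬ (p : ℤ) ∣ k * m := fun hd => by
  rcases (Nat.prime_iff_prime_int.1 h.prime).dvd_or_dvd hd with h1 | h1
  · exact absurd (Int.le_of_dvd hk ((dvd_abs _ _).2 h1)) (by omega)
  · exact hm h1

/-- Valuations from `K` are multiples of `p`, so the `k`-th term has valuation congruent to `k * m`
modulo `p`; these classes are distinct for `k < p`. -/
theorem abv_algebraMap_mul_pow_injOn {b : L} {m : ℤ} (hb : N b = r ^ m) (hm : ¬ (p : ℤ) ∣ m)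
    (c : ℕ → K) : ∀ k ∈ Finset.range p, ∀ l ∈ Finset.range p, k ≠ l →
    algebraMap K L (c k) * b ^ k ≠ 0 →
      N (algebraMap K L (c k) * b ^ k) ≠ N (algebraMap K L (c l) * b ^ l) := by
  intro k hk l hl hkl h0 heq
  rw [Finset.mem_range] at hk hl
  have hl0 : algebraMap K L (c l) * b ^ l ≠ 0 := by
    rwa [← N.ne_zero_iff, ← heq, N.ne_zero_iff]
  have hck : c k ≠ 0 := by rintro e; simp [e] at h0
  have hcl : c l ≠ 0 := by rintro e; simp [e] at hl0
  obtain ⟨n, hn⟩ := h.exists_abv_algebraMap_eq _ hck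
  obtain ⟨n', hn'⟩ := h.exists_abv_algebraMap_eq _ hcl
  rw [map_mul, map_mul, map_pow, map_pow, hn, hn', hb, ← zpow_natCast, ← zpow_natCast, ← zpow_mul,
    ← zpow_mul, ← h.zpow_add, ← h.zpow_add] at heq
  have := h.zpow_inj heq
  refine h.not_dvd_mul hm (k := (k : ℤ) - l) ?_ ?_ ⟨n' - n, by linear_combination this⟩
  · exact abs_pos.2 (by omega)
  · rw [abs_lt]
    omega

/-- The powers of an element of valuation prime to `p` form an orthogonal basis. -/
theorem exists_eq_sum {b : L} {m : ℤ} (hb : N b = r ^ m) (hm : ¬ (p : ℤ) ∣ m) (z : L) :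
    ∃ c : ℕ → K, z = ∑ k ∈ Finset.range p, algebraMap K L (c k) * b ^ k ∧
      ∀ k < p, N (algebraMap K L (c k) * b ^ k) ≤ N z := by
  have hb0 : b ≠ 0 := by
    rw [← N.ne_zero_iff, hb]
    exact (zpow_pos h.pos _).ne'
  have hli : LinearIndependent K fun k : Fin p => b ^ (k : ℕ) := by
    rw [Fintype.linearIndependent_iff]
    intro g hg k
    let c : ℕ → K := fun n => if hn : n < p then g ⟨n, hn⟩ else 0
    have hc : ∀ k : Fin p, c k = g k := fun k => by simp [c]
    have hsum : ∑ k ∈ Finset.range p, algebraMap K L (c k) * b ^ k = 0 := by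
      rw [← Fin.sum_univ_eq_sum_range (fun k => algebraMap K L (c k) * b ^ k), ← hg]
      exact Finset.sum_congr rfl fun k _ => by rw [hc, Algebra.smul_def]
    have := h.nonarch.abv_le_abv_sum (h.abv_algebraMap_mul_pow_injOn hb hm c) k
      (Finset.mem_range.2 k.2)
    rw [hsum, map_zero] at this
    have h0 := N.eq_zero.1 (this.antisymm (N.nonneg _))
    rw [← hc]
    simpa [hb0] using h0
  have : Nonempty (Fin p) := ⟨⟨0, h.prime.pos⟩⟩
  let B := basisOfLinearIndependentOfCardEqFinrank hli (by rw [Fintype.card_fin, h.finrank_eq])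
  let c : ℕ → K := fun n => if hn : n < p then B.repr z ⟨n, hn⟩ else 0
  have hz : z = ∑ k ∈ Finset.range p, algebraMap K L (c k) * b ^ k := by
    rw [← Fin.sum_univ_eq_sum_range (fun k => algebraMap K L (c k) * b ^ k)]
    conv_lhs => rw [← B.sum_repr z]
    exact Finset.sum_congr rfl fun k _ => by simp [c, B, Algebra.smul_def]
  refine ⟨c, hz, fun k hk => ?_⟩
  conv_rhs => rw [hz]
  exact h.nonarch.abv_le_abv_sum (h.abv_algebraMap_mul_pow_injOn hb hm c) k (Finset.mem_range.2 hk)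

theorem not_dvd_one : ¬ (p : ℤ) ∣ 1 := by
  have := h.prime.two_le
  intro hd
  have := Int.le_of_dvd one_pos hd
  omega

/-- Best approximation by elements of the base field. -/
theorem exists_approx (z : L) : ∃ a : K, N (z - algebraMap K L a) ≤ N z ∧
    (z = algebraMap K L a ∨ ∃ m : ℤ, ¬ (p : ℤ) ∣ m ∧ N (z - algebraMap K L a) = r ^ m) := by
  obtain ⟨b, hb⟩ := h.exists_abv_eq_zpow 1
  obtain ⟨c, hz, hc⟩ := h.exists_eq_sum hb h.not_dvd_one z
  have h0 : 0 ∈ Finset.range p := Finset.mem_range.2 h.prime.pos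
  have hza : z - algebraMap K L (c 0) =
      ∑ k ∈ (Finset.range p).erase 0, algebraMap K L (c k) * b ^ k := by
    conv_lhs => rw [hz, ← Finset.add_sum_erase _ _ h0]
    simp
  -- The approximation is the coefficient of `b ^ 0`: every remaining nonzero term has valuation
  -- prime to `p`.
  refine ⟨c 0, h.nonarch.abv_sub_le le_rfl (by simpa using hc 0 h.prime.pos), ?_⟩
  rcases eq_or_ne z (algebraMap K L (c 0)) with he | hne
  · exact Or.inl he
  right
  have hinj := h.abv_algebraMap_mul_pow_injOn hb h.not_dvd_one c
  have hne' : ((Finset.range p).erase 0).Nonempty := by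
    rw [Finset.nonempty_iff_ne_empty]
    intro he
    rw [he, Finset.sum_empty, sub_eq_zero] at hza
    exact hne hza
  obtain ⟨k, hk, hmax⟩ := Finset.exists_max_image _
    (fun k => N (algebraMap K L (c k) * b ^ k)) hne'
  have hk' := Finset.mem_erase.1 hk
  have hk0 : algebraMap K L (c k) * b ^ k ≠ 0 := by
    intro he
    refine hne (sub_eq_zero.1 (hza.trans (Finset.sum_eq_zero fun l hl => ?_)))
    have := hmax l hl
    rw [he, map_zero] at this
    exact N.eq_zero.1 (this.antisymm (N.nonneg _))
  have hN : N (z - algebraMap K L (c 0)) = N (algebraMap K L (c k) * b ^ k) := by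
    rw [hza]
    exact IsNonarchimedean.apply_sum_eq_of_lt h.nonarch (fun a => (N.map_neg a).symm) hk
      fun l hl hlk => lt_of_le_of_ne (hmax l hl)
        (hinj k hk'.2 l (Finset.mem_erase.1 hl).2 hlk.symm hk0).symm
  obtain ⟨n, hn⟩ := h.exists_abv_algebraMap_eq (c k) (by rintro e; simp [e] at hk0)
  refine ⟨p * n + k, ?_, ?_⟩
  · rw [Int.dvd_add_right (Dvd.intro _ rfl), Int.natCast_dvd_natCast]
    have := Finset.mem_range.1 hk'.2
    exact fun hd => absurd (Nat.le_of_dvd (Nat.pos_of_ne_zero hk'.1) hd) (by omega)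
  · rw [hN, map_mul, hn, map_pow, hb, zpow_one, h.zpow_add, zpow_natCast]

/-- Total ramification leaves the residue field unchanged: an approximation error of valuation prime
to `p` cannot be a unit. -/
theorem exists_base_sub_lt {u : L} (hu : N u = 1) : ∃ c : K, N (u - algebraMap K L c) < 1 := by
  obtain ⟨a, ha, rfl | ⟨m, hm, hm'⟩⟩ := h.exists_approx u
  · exact ⟨a, by simp⟩
  · refine ⟨a, lt_of_le_of_ne (hu ▸ ha) fun he => hm ?_⟩
    rw [hm', ← zpow_zero r] at he
    rw [h.zpow_inj he]
    exact dvd_zero _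

end IsTotallyRamifiedOfPrimeDegree

/-- `σ` shifts the valuation by at least `i`, and by exactly `i` where it is prime to `p`. -/
structure IsShift (p : ℕ) (N : AbsoluteValue L ℝ) (r : ℝ) (i : ℕ) (σ : L ≃ₐ[K] L) : Prop where
  pos : 0 < i
  le : ∀ x, N (σ x - x) ≤ r ^ i * N x
  eq : ∀ x, ∀ m : ℤ, N x = r ^ m → ¬ (p : ℤ) ∣ m → N (σ x - x) = r ^ i * N x

/-! ### Distance to `K` measured by the shift. -/

namespace IsTotallyRamifiedOfPrimeDegree

variable (h : IsTotallyRamifiedOfPrimeDegree p K N r) {i : ℕ} {σ : L ≃ₐ[K] L}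
  (hσ : IsShift p N r i σ)
include h hσ

/-- `σ` fixes `a`, and the error `z - a` is zero or has valuation prime to `p`, where the shift is
exact. -/
theorem exists_abv_sub_eq (z : L) :
    ∃ a : K, N (σ z - z) = r ^ i * N (z - algebraMap K L a) := by
  obtain ⟨a, -, rfl | ⟨m, hm, hm'⟩⟩ := h.exists_approx z
  · exact ⟨a, by simp⟩
  · refine ⟨a, ?_⟩
    rw [← hσ.eq _ m hm' hm]
    simp

theorem exists_abv_sub_eq_zpow {z : L} {n : ℤ} (hz : N (σ z - z) = r ^ n) :
    ∃ a : K, N (z - algebraMap K L a) = r ^ (n - i) := by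
  obtain ⟨a, ha⟩ := h.exists_abv_sub_eq hσ z
  refine ⟨a, ?_⟩
  rw [zpow_sub₀ h.pos.ne', ← hz, ha, zpow_natCast, mul_comm,
    mul_div_cancel_right₀ _ (pow_ne_zero _ h.pos.ne')]

theorem exists_abv_sub_le_zpow {z : L} {n : ℤ} (hz : N (σ z - z) ≤ r ^ n) :
    ∃ a : K, N (z - algebraMap K L a) ≤ r ^ (n - i) := by
  obtain ⟨a, ha⟩ := h.exists_abv_sub_eq hσ z
  refine ⟨a, ?_⟩
  rw [zpow_sub₀ h.pos.ne', le_div_iff₀ (zpow_pos h.pos _), zpow_natCast, mul_comm, ← ha]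
  exact hz

/-- Expand `(z + w) ^ p` with `w = σ z - z`: the cross terms carry a factor `p`, and `w` has
valuation exactly `m + i`. -/
theorem abv_shift_pow_sub_le {e : ℤ} (hpe : N (p : L) = r ^ (p * e)) {z : L} {m : ℤ}
    (hz : N z = r ^ m) (hm : ¬ (p : ℤ) ∣ m) :
    N (σ (z ^ p) - z ^ p - (σ z - z) ^ p) ≤ r ^ (p * e + p * m + i) ∧
      N ((σ z - z) ^ p) = r ^ (p * m + p * i : ℤ) := by
  have hw := hσ.eq z m hz hm
  have hri : r ^ i ≤ 1 := pow_le_one₀ h.pos.le h.lt_one.le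
  have hle : N (σ z - z) ≤ N z := by
    rw [hw]
    exact mul_le_of_le_one_left (N.nonneg _) hri
  constructor
  · have := h.nonarch.abv_add_pow_prime_sub_le h.prime hle
    rw [add_sub_cancel] at this
    rw [map_pow]
    refine this.trans (le_of_eq ?_)
    have hp1 := h.prime.pos
    rw [hw, hpe, hz, ← zpow_natCast, ← zpow_natCast, ← zpow_mul, ← h.zpow_add, ← h.zpow_add,
      ← h.zpow_add]
    congr 1
    have : ((p - 1 : ℕ) : ℤ) = p - 1 := by omega
    rw [this]
    ring
  · rw [map_pow, hw, hz, ← zpow_natCast, ← zpow_natCast, ← h.zpow_add, ← zpow_mul]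
    congr 1
    ring

theorem exists_abv_pow_sub_eq {e : ℤ} (hpe : N (p : L) = r ^ (p * e)) {z : L} {m : ℤ}
    (hz : N z = r ^ m) (hm : ¬ (p : ℤ) ∣ m) (hi : (p * i : ℤ) < p * e + i) :
    ∃ a : K, N (z ^ p - algebraMap K L a) = r ^ (p * m + p * i - i : ℤ) := by
  obtain ⟨h1, h2⟩ := h.abv_shift_pow_sub_le hσ hpe hz hm
  refine h.exists_abv_sub_eq_zpow hσ ?_
  rw [h.nonarch.abv_eq_of_sub_lt (y := (σ z - z) ^ p), h2]
  rw [h2]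
  refine h1.trans_lt (h.zpow_lt.2 ?_)
  linarith

theorem exists_abv_pow_sub_le {e : ℤ} (hpe : N (p : L) = r ^ (p * e)) {z : L} {m n : ℤ}
    (hz : N z = r ^ m) (hm : ¬ (p : ℤ) ∣ m) (hn1 : n ≤ p * m + p * i - i)
    (hn2 : n ≤ p * m + p * e) :
    ∃ a : K, N (z ^ p - algebraMap K L a) ≤ r ^ n := by
  obtain ⟨h1, h2⟩ := h.abv_shift_pow_sub_le hσ hpe hz hm
  have := h.exists_abv_sub_le_zpow hσ (z := z ^ p) (n := n + i) ?_
  · rwa [add_sub_cancel_right] at this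
  rw [← sub_add_cancel (σ (z ^ p) - z ^ p) ((σ z - z) ^ p)]
  refine h.nonarch.abv_add_le (h1.trans (h.zpow_le.2 (by linarith))) ?_
  rw [h2, h.zpow_le]
  linarith

end IsTotallyRamifiedOfPrimeDegree

end PrimeDegree

theorem not_natCast_dvd_neg_natCast {p m : ℕ} (hm : ¬ p ∣ m) : ¬ (p : ℤ) ∣ -(m : ℤ) := by
  rwa [Int.dvd_neg, Int.natCast_dvd_natCast]

/-! ### Attaining a prescribed pole order for `a - b ^ p + b`. -/

section PrimeDegree

variable {p : ℕ} {K L : Type*} [Field K] [Field L] [Algebra K L] {N : AbsoluteValue L ℝ} {r : ℝ}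

namespace IsTotallyRamifiedOfPrimeDegree

variable (h : IsTotallyRamifiedOfPrimeDegree p K N r) {i : ℕ} {σ : L ≃ₐ[K] L}
  (hσ : IsShift p N r i σ)
include h

/-- This is the moderate pole condition: it makes the cross terms of `(b + y) ^ p` smaller than `y`
whenever `|y| ≤ |b|`. -/
theorem abv_natCast_mul_pow_lt_one {e j : ℕ} (hpe : N (p : L) = r ^ (p * e : ℤ))
    (hj : p * j < p * e + j) {b : L} (hb : N b = r ^ (-j : ℤ)) :
    N (p : L) * N b ^ (p - 1) < 1 := by
  rw [hpe, hb, ← zpow_natCast, ← zpow_mul, ← h.zpow_add, ← zpow_zero r, h.zpow_lt,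
    Nat.cast_sub h.prime.one_le]
  push_cast
  zify at hj
  linarith

include hσ

theorem exists_reduction_of_lt {e : ℤ} (hpe : N (p : L) = r ^ (p * e)) {j : ℕ} (hpj : ¬ p ∣ j)
    (hj : (p * j : ℤ) < p * e + j) (hji : j < i) :
    ∃ (a : K) (b : L), N b = r ^ (-j : ℤ) ∧ N (algebraMap K L a - b ^ p + b) = r ^ (-j : ℤ) := by
  obtain ⟨b, hb⟩ := h.exists_abv_eq_zpow (-j)
  have hp2 : (2 : ℤ) ≤ p := by exact_mod_cast h.prime.two_le
  have hji' : (j : ℤ) + 1 ≤ i := by exact_mod_cast hji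
  -- One order better than `b`, so that `b` alone decides the pole.
  obtain ⟨a, ha⟩ := h.exists_abv_pow_sub_le hσ hpe hb (not_natCast_dvd_neg_natCast hpj)
    (n := -j + 1) (by nlinarith) (by linarith)
  refine ⟨a, b, hb, ?_⟩
  rw [← hb]
  refine h.nonarch.add_eq_right_of_lt ?_
  rw [N.map_sub, hb]
  exact ha.trans_lt (h.zpow_lt.2 (by omega))

theorem exists_reduction_of_gt {e : ℤ} (hpe : N (p : L) = r ^ (p * e)) {j s : ℕ} (hpj : ¬ p ∣ j)
    (hi : (p * i : ℤ) < p * e + i) (hij : i < j) (hs : (s : ℤ) = p * j - (p - 1) * i) :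
    ∃ (a : K) (b : L), N b = r ^ (-j : ℤ) ∧ N (algebraMap K L a - b ^ p + b) = r ^ (-s : ℤ) := by
  obtain ⟨b, hb⟩ := h.exists_abv_eq_zpow (-j)
  have hp2 : (2 : ℤ) ≤ p := by exact_mod_cast h.prime.two_le
  have hij' : (i : ℤ) + 1 ≤ j := by exact_mod_cast hij
  obtain ⟨a, ha⟩ := h.exists_abv_pow_sub_eq hσ hpe hb (not_natCast_dvd_neg_natCast hpj) hi
  refine ⟨a, b, hb, ?_⟩
  rw [show (-s : ℤ) = p * (-j) + p * i - i by rw [hs]; ring, ← ha]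
  refine (h.nonarch.add_eq_left_of_lt ?_).trans (N.map_sub _ _)
  rw [N.map_sub, ha, hb, h.zpow_lt]
  nlinarith

/-- If `b` cancels the leading term of `a - b ^ p`, scaling by `w` leaves `-(w ^ p - w) * b` up to
smaller terms, which still has pole order `i`. -/
theorem exists_reduction_of_residue {e : ℤ} (hpe : N (p : L) = r ^ (p * e)) (hpi : ¬ p ∣ i)
    (hi : (p * i : ℤ) < p * e + i) {w : K}
    (hw : N (algebraMap K L w) ≤ 1) (hw' : N (algebraMap K L (w ^ p - w)) = 1) :
    ∃ (a : K) (b : L), N b = r ^ (-i : ℤ) ∧ N (algebraMap K L a - b ^ p + b) = r ^ (-i : ℤ) := by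
  obtain ⟨b, hb⟩ := h.exists_abv_eq_zpow (-i)
  obtain ⟨a, ha⟩ := h.exists_abv_pow_sub_eq hσ hpe hb (not_natCast_dvd_neg_natCast hpi) hi
  rw [show (p * -i + p * i - i : ℤ) = -i by ring] at ha
  set c := algebraMap K L a - b ^ p + b with hc
  have hle : N c ≤ r ^ (-i : ℤ) := h.nonarch.abv_add_le (by rw [N.map_sub, ha]) hb.le
  rcases hle.lt_or_eq with hlt | heq
  swap
  · exact ⟨a, b, hb, heq⟩
  have hw1 : N (algebraMap K L w) = 1 := by
    refine le_antisymm hw (not_lt.1 fun hlt => ?_)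
    have : N (algebraMap K L (w ^ p - w)) < 1 := by
      rw [map_sub]
      refine h.nonarch.abv_sub_lt ?_ hlt
      rw [map_pow, map_pow]
      exact pow_lt_one₀ (N.nonneg _) hlt h.prime.ne_zero
    exact this.ne hw'
  refine ⟨w ^ p * a, algebraMap K L w * b, by rw [map_mul, hw1, hb, one_mul], ?_⟩
  have hN : N (algebraMap K L (w ^ p - w) * b) = r ^ (-i : ℤ) := by
    rw [map_mul, hw', hb, one_mul]
  rw [show algebraMap K L (w ^ p * a) - (algebraMap K L w * b) ^ p + algebraMap K L w * b =
    algebraMap K L w ^ p * c - algebraMap K L (w ^ p - w) * b by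
      rw [hc, map_mul, map_pow, map_sub, map_pow]; ring, sub_eq_add_neg, ← hN,
    ← N.map_neg (algebraMap K L (w ^ p - w) * b)]
  refine h.nonarch.add_eq_right_of_lt ?_
  rw [N.map_neg, hN, map_mul, map_pow, hw1, one_pow, one_mul]
  exact hlt

/-- Adding `z` to `b` changes the reduction essentially by `z`: since `m < i`, the power `z ^ p` is
absorbed into `K` up to an error smaller than `z`, and the cross terms are smaller too. -/
theorem exists_reduction_step {e : ℕ} (hpe : N (p : L) = r ^ (p * e : ℤ))
    (hi : p * i < p * e + i) (a : K) {b z : L} (hb : N b = r ^ (-i : ℤ)) {m : ℤ}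
    (hz : N z = r ^ (-m)) (hm : ¬ (p : ℤ) ∣ m) (hmi : m < i) :
    ∃ a' : K, N (b + z) = r ^ (-i : ℤ) ∧
      N (algebraMap K L a' - (b + z) ^ p + (b + z) - (algebraMap K L a - b ^ p + b + z))
        < r ^ (-m) := by
  have hzb : N z < N b := by
    rw [hz, hb, h.zpow_lt]
    omega
  have hp2 : (2 : ℤ) ≤ p := by exact_mod_cast h.prime.two_le
  obtain ⟨a', ha'⟩ := h.exists_abv_pow_sub_eq hσ hpe hz (by rwa [Int.dvd_neg])
    (by exact_mod_cast hi)
  refine ⟨a + a', by rw [h.nonarch.add_eq_left_of_lt hzb, hb], ?_⟩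
  rw [show algebraMap K L (a + a') - (b + z) ^ p + (b + z) - (algebraMap K L a - b ^ p + b + z) =
    -(z ^ p - algebraMap K L a') - ((b + z) ^ p - b ^ p - z ^ p) by rw [map_add]; ring]
  refine h.nonarch.abv_sub_lt ?_ ?_
  · rw [N.map_neg, ha', h.zpow_lt]
    nlinarith
  · refine (h.nonarch.abv_add_pow_prime_sub_le h.prime hzb.le).trans_lt ?_
    rw [← hz]
    exact mul_lt_of_lt_one_left (by rw [hz]; exact zpow_pos h.pos _)
      (h.abv_natCast_mul_pow_lt_one hpe hi hb)

/-- Scale `b` so that `σ b - b` is congruent to `1`, a residue class fixed by Frobenius. Then `σ`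
moves `b ^ p - b` by less than a unit, so this element lies within pole order `i - 1` of `K`. -/
theorem exists_reduction_lt_pole {e : ℕ} (hpe : N (p : L) = r ^ (p * e : ℤ)) (hp : N (p : L) < 1)
    (hpi : ¬ p ∣ i) (hi : p * i < p * e + i) :
    ∃ (a : K) (b : L), N b = r ^ (-i : ℤ) ∧
      N (algebraMap K L a - b ^ p + b) ≤ r ^ (-(i - 1 : ℤ)) := by
  obtain ⟨b₀, hb₀⟩ := h.exists_abv_eq_zpow (-i)
  have hu : N (σ b₀ - b₀) = 1 := by
    rw [hσ.eq _ _ hb₀ (not_natCast_dvd_neg_natCast hpi), hb₀, ← zpow_natCast, ← h.zpow_add,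
      add_neg_cancel, zpow_zero]
  obtain ⟨c, hc⟩ := h.exists_base_sub_lt hu
  have hc1 : N (algebraMap K L c) = 1 := by
    rw [← hu]
    exact h.nonarch.abv_eq_of_sub_lt (by rwa [N.map_sub, hu])
  have hc0 : algebraMap K L c ≠ 0 := by
    rw [← N.ne_zero_iff, hc1]
    exact one_ne_zero
  set b := b₀ / algebraMap K L c with hbdef
  have hb : N b = r ^ (-i : ℤ) := by rw [hbdef, map_div₀, hb₀, hc1, div_one]
  set ε := σ b - b - 1 with hε
  have hε1 : N ε < 1 := by
    have : ε = (σ b₀ - b₀ - algebraMap K L c) / algebraMap K L c := by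
      rw [hε, hbdef, map_div₀, AlgEquiv.commutes]
      field_simp
    rwa [this, map_div₀, hc1, div_one]
  have hσb : σ b = b + (1 + ε) := by rw [hε]; ring
  have h1ε : N (1 + ε) = 1 := by
    rw [h.nonarch.add_eq_left_of_lt (by rwa [map_one]), map_one]
  have hb1 : 1 ≤ N b := by
    rw [hb, ← zpow_zero r, h.zpow_le]
    omega
  have hlt : N (σ (b ^ p - b) - (b ^ p - b)) < r ^ (0 : ℤ) := by
    rw [zpow_zero, show σ (b ^ p - b) - (b ^ p - b) =
      ((b + (1 + ε)) ^ p - b ^ p - (1 + ε) ^ p) +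
        (((1 + ε) ^ p - 1 ^ p - ε ^ p) + (ε ^ p - ε)) by
      rw [map_sub, map_pow, hσb]; ring]
    refine h.nonarch.abv_add_lt ?_ (h.nonarch.abv_add_lt ?_ (h.nonarch.abv_sub_lt ?_ hε1))
    · refine (h.nonarch.abv_add_pow_prime_sub_le h.prime (by rwa [h1ε])).trans_lt ?_
      rw [h1ε, mul_one]
      exact h.abv_natCast_mul_pow_lt_one hpe hi hb
    · refine (h.nonarch.abv_add_pow_prime_sub_le h.prime
        (by rw [map_one]; exact hε1.le)).trans_lt ?_
      rw [map_one, one_pow, mul_one]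
      exact mul_lt_one_of_nonneg_of_lt_one_left (N.nonneg _) hp hε1.le
    · rw [map_pow]
      exact pow_lt_one₀ (N.nonneg _) hε1 h.prime.ne_zero
  obtain ⟨a, ha⟩ := h.exists_abv_sub_le_zpow hσ (h.le_of_lt_zpow hlt)
  refine ⟨a, b, hb, ?_⟩
  rw [show algebraMap K L a - b ^ p + b = algebraMap K L a - (b ^ p - b) by ring, N.map_sub]
  convert ha using 2
  ring

theorem exists_reduction_le {e s : ℕ} (hpe : N (p : L) = r ^ (p * e : ℤ)) (hp : N (p : L) < 1)
    (hpi : ¬ p ∣ i) (hi : p * i < p * e + i) (hsi : s < i) :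
    ∃ (a : K) (b : L), N b = r ^ (-i : ℤ) ∧ N (algebraMap K L a - b ^ p + b) ≤ r ^ (-s : ℤ) := by
  -- Induct on the number of orders gained beyond the initial `i - 1`.
  suffices ∀ n : ℕ, n + s < i → ∃ (a : K) (b : L), N b = r ^ (-i : ℤ) ∧
      N (algebraMap K L a - b ^ p + b) ≤ r ^ (-(i - 1 - n : ℤ)) by
    obtain ⟨a, b, hb, hc⟩ := this (i - 1 - s) (by omega)
    refine ⟨a, b, hb, ?_⟩
    convert hc using 2
    omega
  intro n
  induction n with
  | zero =>
    intro _
    simpa using h.exists_reduction_lt_pole hσ hpe hp hpi hi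
  | succ n ih =>
    intro hn
    obtain ⟨a, b, hb, hc⟩ := ih (by omega)
    obtain ⟨a₀, hle, hy⟩ := h.exists_approx (algebraMap K L a - b ^ p + b)
    set y := algebraMap K L a - b ^ p + b - algebraMap K L a₀ with hydef
    have hy' : algebraMap K L (a - a₀) - b ^ p + b = y := by
      rw [hydef, map_sub]
      ring
    have hexp : (-(i - 1 - (n + 1 : ℕ)) : ℤ) = -(i - 1 - n : ℤ) + 1 := by
      push_cast
      ring
    rcases (hle.trans hc).lt_or_eq with hlt | heq
    · refine ⟨a - a₀, b, hb, ?_⟩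
      rw [hy', hexp]
      exact h.le_of_lt_zpow hlt
    · rcases hy with h0 | ⟨m, hm, hm'⟩
      · rw [hydef, sub_eq_zero.2 h0, map_zero] at heq
        exact absurd heq (zpow_pos h.pos _).ne
      -- After subtracting its best approximation in `K`, the remainder `y` has pole order prime to
      -- `p`; replacing `b` by `b - y` removes it.
      · have hmn := h.zpow_inj (hm'.symm.trans heq)
        obtain ⟨a', hb', ha'⟩ := h.exists_reduction_step hσ hpe hi (a - a₀) hb (z := -y)
          (m := i - 1 - n) (by rw [N.map_neg, heq]) (by rwa [← Int.dvd_neg, ← hmn]) (by omega)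
        refine ⟨a', b + -y, hb', ?_⟩
        rw [hy', add_neg_cancel, sub_zero] at ha'
        rw [hexp]
        exact h.le_of_lt_zpow ha'

/-- If the pole drops below order `s`, put an element of exact pole order `s` back by one more
correction. -/
theorem exists_reduction_of_eq {e s : ℕ} (hpe : N (p : L) = r ^ (p * e : ℤ)) (hp : N (p : L) < 1)
    (hpi : ¬ p ∣ i) (hi : p * i < p * e + i) (hps : ¬ p ∣ s) (hsi : s < i) :
    ∃ (a : K) (b : L), N b = r ^ (-i : ℤ) ∧ N (algebraMap K L a - b ^ p + b) = r ^ (-s : ℤ) := by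
  obtain ⟨a, b, hb, hc⟩ := h.exists_reduction_le hσ hpe hp hpi hi hsi
  rcases hc.lt_or_eq with hlt | heq
  swap
  · exact ⟨a, b, hb, heq⟩
  obtain ⟨z, hz⟩ := h.exists_abv_eq_zpow (-s)
  obtain ⟨a', hb', ha'⟩ := h.exists_reduction_step hσ hpe hi a hb hz
    (by rwa [Int.natCast_dvd_natCast]) (by exact_mod_cast hsi)
  refine ⟨a', b + z, hb', ?_⟩
  rw [← hz]
  refine h.nonarch.abv_eq_of_sub_lt ?_
  rw [hz]
  have := h.nonarch.abv_add_lt ha' hlt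
  convert this using 2
  ring

end IsTotallyRamifiedOfPrimeDegree

end PrimeDegree

/-! ### The absolute value on extensions of `ℚ_p` and its discreteness. -/

section PadicAbs

variable (p : ℕ) [Fact p.Prime]

/-- The extension of the `p`-adic absolute value to an algebraic extension of `ℚ_p`. -/
noncomputable def padicAbs (E : Type*) [Field E] [Algebra ℚ_[p] E] [Algebra.IsAlgebraic ℚ_[p] E] :
    AbsoluteValue E ℝ where
  toFun := spectralMulAlgNorm ℚ_[p] E
  map_mul' := map_mul _
  nonneg' := apply_nonneg _
  eq_zero' _ := map_eq_zero_iff_eq_zero _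
  add_le' := map_add_le_add _

variable {E : Type*} [Field E] [Algebra ℚ_[p] E] [Algebra.IsAlgebraic ℚ_[p] E]

theorem padicAbs_apply (x : E) : padicAbs p E x = spectralNorm ℚ_[p] E x := rfl

theorem isNonarchimedean_padicAbs : IsNonarchimedean (padicAbs p E) :=
  isNonarchimedean_spectralNorm (K := ℚ_[p]) (L := E)

theorem mem_padicRingOfIntegers_iff_padicAbs (x : E) :
    x ∈ padicRingOfIntegers p E ↔ padicAbs p E x ≤ 1 :=
  mem_padicRingOfIntegers_iff p x

theorem padicAbs_natCast : padicAbs p E (p : E) = (p : ℝ)⁻¹ := by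
  rw [padicAbs_apply, ← map_natCast (algebraMap ℚ_[p] E) p, spectralNorm_extends, Padic.norm_p]

theorem padicAbs_natCast_pos : 0 < padicAbs p E (p : E) := by
  rw [padicAbs_natCast]
  have := (Fact.out : p.Prime).pos
  positivity

theorem padicAbs_natCast_lt_one : padicAbs p E (p : E) < 1 := by
  rw [padicAbs_natCast]
  exact inv_lt_one_of_one_lt₀ (by exact_mod_cast (Fact.out : p.Prime).one_lt)

theorem padicAbs_algebraMap {F : Type*} [Field F] [Algebra ℚ_[p] F] [Algebra.IsAlgebraic ℚ_[p] F]
    [Algebra F E] [IsScalarTower ℚ_[p] F E] (x : F) :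
    padicAbs p E (algebraMap F E x) = padicAbs p F x :=
  (spectralNorm.eq_of_tower x).symm

theorem padicAbs_algEquiv {F : Type*} [Field F] [Algebra ℚ_[p] F] [Algebra F E]
    [IsScalarTower ℚ_[p] F E] (σ : E ≃ₐ[F] E) (x : E) : padicAbs p E (σ x) = padicAbs p E x :=
  (spectralNorm_eq_of_equiv (σ.restrictScalars ℚ_[p]) x).symm

/-- `ϖ` generates the value group of `E`. -/
structure IsPadicUniformizer (ϖ : E) : Prop where
  pos : 0 < padicAbs p E ϖ
  lt_one : padicAbs p E ϖ < 1
  exists_eq : ∀ x : E, x ≠ 0 → ∃ n : ℤ, padicAbs p E x = padicAbs p E ϖ ^ n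

/-- The constant coefficient of the minimal polynomial is, up to sign, a product of conjugates of
equal absolute value, and its degree divides that of `E`. -/
theorem exists_padicAbs_pow_finrank_eq [FiniteDimensional ℚ_[p] E] {x : E} (hx : x ≠ 0) :
    ∃ n : ℤ, padicAbs p E x ^ Module.finrank ℚ_[p] E = (p : ℝ)⁻¹ ^ n := by
  have hint : IsIntegral ℚ_[p] x := Algebra.IsIntegral.isIntegral x
  have hdeg := minpoly.natDegree_pos hint
  obtain ⟨m, hm⟩ := Padic.padicNormE.image (minpoly.coeff_zero_ne_zero hint hx)
  obtain ⟨d, hd⟩ := minpoly.degree_dvd hint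
  have h1 : padicAbs p E x ^ (minpoly ℚ_[p] x).natDegree = ‖(minpoly ℚ_[p] x).coeff 0‖ := by
    rw [padicAbs_apply, spectralNorm.spectralNorm_eq_norm_coeff_zero_rpow, ← Real.rpow_natCast,
      ← Real.rpow_mul (norm_nonneg _), one_div_mul_cancel (by positivity), Real.rpow_one]
  refine ⟨m * d, ?_⟩
  rw [hd, pow_mul, h1, hm, zpow_mul]
  push_cast
  rw [inv_zpow, zpow_neg, zpow_natCast]

theorem exists_isPadicUniformizer [FiniteDimensional ℚ_[p] E] :
    ∃ ϖ : E, IsPadicUniformizer p ϖ := by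
  classical
  set d := Module.finrank ℚ_[p] E with hd
  have hd0 : d ≠ 0 := Module.finrank_pos.ne'
  have hp1 : (1 : ℝ) < p := by exact_mod_cast (Fact.out : p.Prime).one_lt
  have hq0 : (0 : ℝ) < (p : ℝ)⁻¹ := by positivity
  have hq1 : (p : ℝ)⁻¹ < 1 := inv_lt_one_of_one_lt₀ hp1
  -- An element realizing the least positive exponent `k` is a uniformizer; Euclidean division by
  -- `k` shows that it generates the value group.
  let P : ℕ → Prop := fun k => 0 < k ∧ ∃ x : E, padicAbs p E x ^ d = (p : ℝ)⁻¹ ^ k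
  have hP : ∃ k, P k := ⟨d, Nat.pos_of_ne_zero hd0, (p : E), by rw [padicAbs_natCast]⟩
  obtain ⟨hk, ϖ, hϖ⟩ := Nat.find_spec hP
  set k := Nat.find hP with hkdef
  have hϖ0 : padicAbs p E ϖ ≠ 0 := by
    intro h0
    rw [h0, zero_pow hd0] at hϖ
    exact (pow_pos hq0 k).ne hϖ
  have hϖpos : 0 < padicAbs p E ϖ := lt_of_le_of_ne (AbsoluteValue.nonneg _ _) hϖ0.symm
  refine ⟨ϖ, hϖpos, ?_, fun x hx => ?_⟩
  · by_contra! hge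
    exact absurd (hϖ ▸ one_le_pow₀ hge) (not_le.2 (pow_lt_one₀ hq0.le hq1 hk.ne'))
  · obtain ⟨n, hn⟩ := exists_padicAbs_pow_finrank_eq p hx
    refine ⟨n / k, ?_⟩
    have hk' : (0 : ℤ) < k := by exact_mod_cast hk
    obtain ⟨t, ht⟩ := Int.eq_ofNat_of_zero_le (Int.emod_nonneg n hk'.ne')
    have hy : padicAbs p E (x / ϖ ^ (n / k)) ^ d = (p : ℝ)⁻¹ ^ t := by
      rw [map_div₀, map_zpow₀, div_pow, ← zpow_natCast (_ ^ (n / (k : ℤ))), ← zpow_mul,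
        mul_comm (n / (k : ℤ)), zpow_mul, zpow_natCast, hϖ, hn, ← zpow_natCast, ← zpow_mul,
        ← zpow_sub₀ hq0.ne', ← zpow_natCast _ t, ← ht,
        Int.emod_def]
    have ht0 : t = 0 := by
      by_contra hne
      have := Nat.find_min' hP ⟨Nat.pos_of_ne_zero hne, _, hy⟩
      have h2 := Int.emod_lt_of_pos n hk'
      rw [ht] at h2
      have h3 : t < k := by exact_mod_cast h2
      omega
    rw [ht0, pow_zero, pow_eq_one_iff_of_nonneg (AbsoluteValue.nonneg _ _) hd0, map_div₀,
      map_zpow₀, div_eq_one_iff_eq (zpow_ne_zero _ hϖ0)] at hy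
    exact hy

variable {p}

theorem isUnit_padicRingOfIntegers_iff (x : padicRingOfIntegers p E) :
    IsUnit x ↔ padicAbs p E x = 1 := by
  constructor
  · rintro ⟨u, rfl⟩
    have h1 : padicAbs p E ((u : padicRingOfIntegers p E) : E) *
        padicAbs p E ((u⁻¹ : (padicRingOfIntegers p E)ˣ) : padicRingOfIntegers p E) = 1 := by
      rw [← map_mul, ← MulMemClass.coe_mul, Units.mul_inv]
      exact map_one _
    have h2 := (mem_padicRingOfIntegers_iff_padicAbs p _).1 (u : padicRingOfIntegers p E).2
    have h3 := (mem_padicRingOfIntegers_iff_padicAbs p _).1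
      ((u⁻¹ : (padicRingOfIntegers p E)ˣ) : padicRingOfIntegers p E).2
    have h4 := (padicAbs p E).nonneg ((u : padicRingOfIntegers p E) : E)
    nlinarith
  · intro h
    have hx0 : (x : E) ≠ 0 := by
      intro h0
      rw [h0, map_zero] at h
      exact zero_ne_one h
    have hinv : (x : E)⁻¹ ∈ padicRingOfIntegers p E := by
      rw [mem_padicRingOfIntegers_iff_padicAbs, map_inv₀, h, inv_one]
    exact IsUnit.of_mul_eq_one (⟨_, hinv⟩ : padicRingOfIntegers p E)
      (Subtype.ext (mul_inv_cancel₀ hx0))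

theorem mem_maximalIdeal_padicRingOfIntegers_iff (x : padicRingOfIntegers p E) :
    x ∈ IsLocalRing.maximalIdeal (padicRingOfIntegers p E) ↔ padicAbs p E x < 1 := by
  rw [IsLocalRing.mem_maximalIdeal, mem_nonunits_iff, isUnit_padicRingOfIntegers_iff]
  exact ⟨lt_of_le_of_ne ((mem_padicRingOfIntegers_iff_padicAbs p _).1 x.2), ne_of_lt⟩

namespace IsPadicUniformizer

variable {ϖ : E} (h : IsPadicUniformizer p ϖ)
include h

theorem ne_zero : ϖ ≠ 0 := by
  rintro rfl
  simpa using h.pos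

theorem le_of_lt_one {x : E} (hx : padicAbs p E x < 1) : padicAbs p E x ≤ padicAbs p E ϖ := by
  rcases eq_or_ne x 0 with rfl | h0
  · rw [map_zero]
    exact h.pos.le
  · obtain ⟨n, hn⟩ := h.exists_eq x h0
    rw [hn, ← zpow_zero (padicAbs p E ϖ), zpow_lt_zpow_iff_right_of_lt_one₀ h.pos h.lt_one] at hx
    rw [hn]
    conv_rhs => rw [← zpow_one (padicAbs p E ϖ)]
    rw [zpow_le_zpow_iff_right_of_lt_one₀ h.pos h.lt_one]
    omega

theorem mem_maximalIdeal_pow_iff (n : ℕ) (x : padicRingOfIntegers p E) :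
    x ∈ IsLocalRing.maximalIdeal (padicRingOfIntegers p E) ^ n ↔
      padicAbs p E x ≤ padicAbs p E ϖ ^ n := by
  have hmem : ϖ ∈ padicRingOfIntegers p E :=
    (mem_padicRingOfIntegers_iff_padicAbs p _).2 h.lt_one.le
  have dvd_iff : ∀ (y : padicRingOfIntegers p E) (k : ℕ),
      (⟨ϖ, hmem⟩ : padicRingOfIntegers p E) ^ k ∣ y ↔ padicAbs p E y ≤ padicAbs p E ϖ ^ k := by
    intro y k
    constructor
    · rintro ⟨z, rfl⟩
      rw [MulMemClass.coe_mul, map_mul, SubmonoidClass.coe_pow, map_pow]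
      exact mul_le_of_le_one_right (pow_nonneg h.pos.le _)
        ((mem_padicRingOfIntegers_iff_padicAbs p _).1 z.2)
    · intro hle
      refine ⟨⟨y / ϖ ^ k, ?_⟩, Subtype.ext ?_⟩
      · rw [mem_padicRingOfIntegers_iff_padicAbs, map_div₀, map_pow]
        exact div_le_one_of_le₀ hle (pow_nonneg h.pos.le _)
      · exact (mul_div_cancel₀ _ (pow_ne_zero _ h.ne_zero)).symm
  have hmax : IsLocalRing.maximalIdeal (padicRingOfIntegers p E) = Ideal.span {⟨ϖ, hmem⟩} := by
    ext y
    rw [mem_maximalIdeal_padicRingOfIntegers_iff, Ideal.mem_span_singleton,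
      ← pow_one (⟨ϖ, hmem⟩ : padicRingOfIntegers p E), dvd_iff, pow_one]
    exact ⟨h.le_of_lt_one, fun hy => hy.trans_lt h.lt_one⟩
  rw [hmax, Ideal.span_singleton_pow, Ideal.mem_span_singleton, dvd_iff]

theorem padicAbs_natCast_eq : padicAbs p E (p : E) = padicAbs p E ϖ ^ absRamificationIndex p E := by
  obtain ⟨n, hn⟩ := h.exists_eq (p : E) (by
    rw [← (padicAbs p E).ne_zero_iff]
    exact (padicAbs_natCast_pos p).ne')
  have hn0 : 0 < n := by
    have := padicAbs_natCast_lt_one p (E := E)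
    rwa [hn, ← zpow_zero (padicAbs p E ϖ),
      zpow_lt_zpow_iff_right_of_lt_one₀ h.pos h.lt_one] at this
  obtain ⟨e, rfl⟩ := Int.eq_ofNat_of_zero_le hn0.le
  -- The set is bounded, so the `sSup` in the definition is a true maximum, not the default `0`.
  have hset : {n : ℕ | (p : padicRingOfIntegers p E) ∈
      IsLocalRing.maximalIdeal (padicRingOfIntegers p E) ^ n} = Set.Iic e := by
    ext k
    rw [Set.mem_ofPred_eq, h.mem_maximalIdeal_pow_iff, Set.mem_Iic]
    rw [show ((p : padicRingOfIntegers p E) : E) = p from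
      map_natCast (padicRingOfIntegers p E).subtype p, hn,
      ← zpow_natCast, zpow_le_zpow_iff_right_of_lt_one₀ h.pos h.lt_one]
    exact Nat.cast_le
  rw [hn, absRamificationIndex, hset, csSup_Iic]
  exact zpow_natCast _ _

theorem mem_lowerRamificationGroup_iff {F : Type*} [Field F] [Algebra ℚ_[p] F] [Algebra F E]
    [IsScalarTower ℚ_[p] F E] (n : ℕ) (σ : E ≃ₐ[F] E) :
    σ ∈ lowerRamificationGroup p F E n ↔
      ∀ x : E, padicAbs p E x ≤ 1 → padicAbs p E (σ x - x) ≤ padicAbs p E ϖ ^ (n + 1) := by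
  constructor
  · intro hσ x hx
    obtain ⟨y, hy, hyx⟩ := hσ ⟨x, (mem_padicRingOfIntegers_iff_padicAbs p _).2 hx⟩
    rw [h.mem_maximalIdeal_pow_iff, hyx] at hy
    exact hy
  · intro hσ x
    have hx := hσ x ((mem_padicRingOfIntegers_iff_padicAbs p _).1 x.2)
    have hmem : σ (x : E) - x ∈ padicRingOfIntegers p E :=
      (mem_padicRingOfIntegers_iff_padicAbs p _).2
        (hx.trans (pow_le_one₀ h.pos.le h.lt_one.le))
    exact ⟨⟨_, hmem⟩, (h.mem_maximalIdeal_pow_iff _ _).2 hx, rfl⟩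

end IsPadicUniformizer

end PadicAbs

/-! ### From ramification groups to shifts of the valuation. -/

section PrimeDegree

variable {p : ℕ} {K L : Type*} [Field K] [Field L] [Algebra K L] {N : AbsoluteValue L ℝ} {r : ℝ}

namespace IsTotallyRamifiedOfPrimeDegree

variable (h : IsTotallyRamifiedOfPrimeDegree p K N r) {σ : L ≃ₐ[K] L} (hσ : ∀ x, N (σ x) = N x)
include h hσ

/-- Moving one element of valuation prime to `p` by little forces `σ` to be close to `1`. -/
theorem abv_shift_le_of_generator {b : L} {m : ℤ} (hb : N b = r ^ m) (hm : ¬ (p : ℤ) ∣ m) {n : ℕ}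
    (hn : N (σ b - b) ≤ r ^ n * N b) {x : L} (hx : N x ≤ 1) : N (σ x - x) ≤ r ^ (n + 1) := by
  obtain ⟨c, hxc, hc⟩ := h.exists_eq_sum hb hm x
  have hr : (0 : ℝ) ≤ r ^ n := pow_nonneg h.pos.le _
  rw [show σ x - x = ∑ k ∈ Finset.range p, algebraMap K L (c k) * (σ b ^ k - b ^ k) by
    conv_lhs => rw [hxc]
    rw [map_sum, ← Finset.sum_sub_distrib]
    exact Finset.sum_congr rfl fun k _ => by rw [map_mul, map_pow, AlgEquiv.commutes, mul_sub]]
  refine h.nonarch.abv_sum_le (pow_nonneg h.pos.le _) fun k hk => ?_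
  rcases Nat.eq_zero_or_pos k with rfl | hk0
  · simpa using pow_nonneg h.pos.le _
  have hpow : N (σ b ^ k - b ^ k) ≤ r ^ n * N b ^ k := by
    rw [← Commute.geom_sum₂_mul (Commute.all _ _), map_mul]
    calc _ ≤ N b ^ (k - 1) * (r ^ n * N b) := by
          gcongr
          refine h.nonarch.abv_sum_le (pow_nonneg (N.nonneg _) _) fun l hl => ?_
          rw [map_mul, map_pow, map_pow, hσ, ← pow_add]
          apply le_of_eq
          congr 1
          have := Finset.mem_range.1 hl
          omega
      _ = r ^ n * (N b ^ (k - 1) * N b) := by ring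
      _ = r ^ n * N b ^ k := by rw [← pow_succ, Nat.sub_add_cancel hk0]
  -- For `0 < k < p` the valuation is not divisible by `p`, so the term is not a unit. This
  -- strictness gives the extra factor in `r ^ (n + 1)`.
  have hlt : N (algebraMap K L (c k) * b ^ k) < r ^ (0 : ℤ) := by
    rw [zpow_zero]
    refine lt_of_le_of_ne ((hc k (Finset.mem_range.1 hk)).trans hx) fun he => ?_
    rw [map_mul, map_pow, hb, ← zpow_natCast, ← zpow_mul,
      mul_eq_one_iff_eq_inv₀ (zpow_pos h.pos _).ne', ← zpow_neg] at he
    refine h.abv_algebraMap_ne_zpow ?_ _ he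
    rw [Int.dvd_neg, mul_comm]
    refine h.not_dvd_mul hm ?_ ?_
    · rw [Nat.abs_cast]
      exact_mod_cast hk0
    · rw [Nat.abs_cast]
      exact_mod_cast Finset.mem_range.1 hk
  have hle := h.le_of_lt_zpow hlt
  rw [zero_add, zpow_one, map_mul, map_pow] at hle
  calc N (algebraMap K L (c k) * (σ b ^ k - b ^ k))
      ≤ N (algebraMap K L (c k)) * (r ^ n * N b ^ k) := by rw [map_mul]; gcongr
    _ = r ^ n * (N (algebraMap K L (c k)) * N b ^ k) := by ring
    _ ≤ r ^ n * r := by gcongr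
    _ = r ^ (n + 1) := (pow_succ _ _).symm

/-- The relative bound is stable under products and inverses, so it suffices to have it for a
uniformizer, which uses up one factor `r`, and for units. -/
theorem abv_shift_le {n : ℕ} (hn : ∀ x, N x ≤ 1 → N (σ x - x) ≤ r ^ (n + 1)) (x : L) :
    N (σ x - x) ≤ r ^ n * N x := by
  have hmul : ∀ x y, N (σ x - x) ≤ r ^ n * N x → N (σ y - y) ≤ r ^ n * N y →
      N (σ (x * y) - x * y) ≤ r ^ n * N (x * y) := by
    intro x y hx hy
    rw [show σ (x * y) - x * y = σ x * (σ y - y) + (σ x - x) * y by rw [map_mul]; ring]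
    refine h.nonarch.abv_add_le ?_ ?_
    · rw [map_mul, map_mul, hσ]
      nlinarith [N.nonneg x]
    · rw [map_mul, map_mul]
      nlinarith [N.nonneg y]
  have hinv : ∀ x, N (σ x - x) ≤ r ^ n * N x → N (σ x⁻¹ - x⁻¹) ≤ r ^ n * N x⁻¹ := by
    intro x hx
    rcases eq_or_ne x 0 with rfl | h0
    · simp
    have hσ0 : σ x ≠ 0 := by simpa using h0
    have hN : 0 < N x := N.pos h0
    rw [map_inv₀, inv_sub_inv hσ0 h0, map_div₀, map_mul, hσ, N.map_sub, map_inv₀,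
      div_le_iff₀ (by positivity)]
    refine hx.trans (le_of_eq ?_)
    field_simp
  obtain ⟨b, hb⟩ := h.exists_uniformizer
  have hb' : N (σ b - b) ≤ r ^ n * N b := by
    refine (hn b (hb ▸ h.lt_one.le)).trans (le_of_eq ?_)
    rw [hb, pow_succ]
  have hpow : ∀ k : ℕ, N (σ (b ^ k) - b ^ k) ≤ r ^ n * N (b ^ k) := by
    intro k
    induction k with
    | zero => simpa using pow_nonneg h.pos.le _
    | succ k ih =>
      rw [pow_succ]
      exact hmul _ _ ih hb'
  have hzpow : ∀ k : ℤ, N (σ (b ^ k) - b ^ k) ≤ r ^ n * N (b ^ k) := by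
    rintro (k | k)
    · simpa using hpow k
    · rw [zpow_negSucc]
      exact hinv _ (hpow _)
  rcases eq_or_ne x 0 with rfl | h0
  · simp
  obtain ⟨m, hm⟩ := h.exists_abv_eq x h0
  have hb0 : b ≠ 0 := by
    rw [← N.ne_zero_iff, hb]
    exact h.pos.ne'
  have hu : N (x / b ^ m) = 1 := by
    rw [map_div₀, map_zpow₀, hb, hm, div_self (zpow_pos h.pos _).ne']
  have := hmul (b ^ m) (x / b ^ m) (hzpow m) <| (hn _ hu.le).trans <| by
    rw [hu, mul_one]
    exact pow_le_pow_of_le_one h.pos.le h.lt_one.le (Nat.le_succ _)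
  rwa [mul_div_cancel₀ _ (zpow_ne_zero _ hb0)] at this

/-- An element of valuation prime to `p` moved by less would, through its powers, force the bound `r
^ (i + 2)` on all integers. -/
theorem isShift_of_maximal {i : ℕ} (hi : 0 < i)
    (hle : ∀ x, N x ≤ 1 → N (σ x - x) ≤ r ^ (i + 1))
    (hmax : ∃ x, N x ≤ 1 ∧ r ^ (i + 2) < N (σ x - x)) : IsShift p N r i σ := by
  refine ⟨hi, h.abv_shift_le hσ hle, fun x m hx hm => ?_⟩
  refine le_antisymm (h.abv_shift_le hσ hle x) (not_lt.1 fun hlt => ?_)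
  obtain ⟨y, hy, hy'⟩ := hmax
  refine absurd hy' (not_lt.2 (h.abv_shift_le_of_generator hσ hx hm (n := i + 1) ?_ hy))
  rw [hx, ← zpow_natCast, ← h.zpow_add] at hlt ⊢
  refine (h.le_of_lt_zpow hlt).trans (h.zpow_le.2 ?_)
  push_cast
  linarith

end IsTotallyRamifiedOfPrimeDegree

end PrimeDegree

/-! ### The residue field: perfectness and its prime field. -/

section ResidueField

variable {p : ℕ} [Fact p.Prime] {E : Type*} [Field E] [Algebra ℚ_[p] E]
  [Algebra.IsAlgebraic ℚ_[p] E]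

local notation "κ" => IsLocalRing.ResidueField (padicRingOfIntegers p E)

theorem residue_eq_zero_iff_padicAbs_lt_one (x : padicRingOfIntegers p E) :
    IsLocalRing.residue _ x = 0 ↔ padicAbs p E x < 1 := by
  rw [IsLocalRing.residue_eq_zero_iff, mem_maximalIdeal_padicRingOfIntegers_iff]

instance charP_residueField_padicRingOfIntegers : CharP κ p := by
  rw [CharP.charP_iff_prime_eq_zero Fact.out, ← map_natCast (IsLocalRing.residue _),
    residue_eq_zero_iff_padicAbs_lt_one]
  rw [show ((p : padicRingOfIntegers p E) : E) = p from
    map_natCast (padicRingOfIntegers p E).subtype p]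
  exact padicAbs_natCast_lt_one p

theorem residue_algebraMap_eq_zero_of_norm_lt_one (a : PadicInt.subring p) (ha : ‖(a : ℚ_[p])‖ < 1) :
    IsLocalRing.residue _ (algebraMap (PadicInt.subring p) (padicRingOfIntegers p E) a) = 0 := by
  rw [residue_eq_zero_iff_padicAbs_lt_one]
  change spectralNorm ℚ_[p] E (algebraMap ℚ_[p] E a) < 1
  rwa [spectralNorm_extends]

/-- A monic equation over `ℤ_p` reduces to one over `𝔽_p`, because every element of `ℤ_p` is
congruent to a natural number. -/
theorem isAlgebraic_residueField_padicRingOfIntegers :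
    letI := ZMod.algebra κ p
    Algebra.IsAlgebraic (ZMod p) κ := by
  let := ZMod.algebra κ p
  refine ⟨fun x => ?_⟩
  obtain ⟨x, rfl⟩ := IsLocalRing.residue_surjective x
  obtain ⟨f, hf, hfx⟩ := x.2
  let ρ : PadicInt.subring p →+* κ := (IsLocalRing.residue _).comp
    (algebraMap (PadicInt.subring p) (padicRingOfIntegers p E))
  have hlift : f.map ρ ∈ Polynomial.lifts (algebraMap (ZMod p) κ) := by
    rw [Polynomial.lifts_iff_coeff_lifts]
    intro n
    rw [coeff_map]
    let a : ℤ_[p] := ⟨f.coeff n, (f.coeff n).2⟩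
    refine ⟨(PadicInt.zmodRepr a : ZMod p), ?_⟩
    have hlt : ‖((f.coeff n - (PadicInt.zmodRepr a : PadicInt.subring p) : PadicInt.subring p) :
        ℚ_[p])‖ < 1 := by
      have := PadicInt.sub_zmodRepr_mem a
      rw [IsLocalRing.mem_maximalIdeal, PadicInt.mem_nonunits] at this
      exact this
    have h0 := residue_algebraMap_eq_zero_of_norm_lt_one (E := E) _ hlt
    rw [map_sub, map_sub, map_natCast, map_natCast, sub_eq_zero] at h0
    rw [map_natCast]
    exact h0.symm
  obtain ⟨g, hg, -, hgm⟩ := Polynomial.lifts_and_degree_eq_and_monic hlift (hf.map _)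
  refine IsIntegral.isAlgebraic ⟨g, hgm, ?_⟩
  rw [← eval_map, hg, eval_map]
  have hx0 : eval₂ (algebraMap (PadicInt.subring p) (padicRingOfIntegers p E)) x f = 0 := by
    apply Subtype.ext
    refine Eq.trans ?_ hfx
    exact Polynomial.hom_eval₂ f _ (padicRingOfIntegers p E).subtype x
  rw [← Polynomial.hom_eval₂, hx0, map_zero]

/-- The residue field is perfect. -/
theorem exists_padicAbs_sub_pow_lt_one {x : E} (hx : padicAbs p E x ≤ 1) :
    ∃ y : E, padicAbs p E y ≤ 1 ∧ padicAbs p E (x - y ^ p) < 1 := by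
  let := ZMod.algebra κ p
  have : Algebra.IsAlgebraic (ZMod p) κ := isAlgebraic_residueField_padicRingOfIntegers
  have : PerfectField κ := Algebra.IsAlgebraic.perfectField (K := ZMod p)
  have : PerfectRing κ p := PerfectField.toPerfectRing p
  let x' : padicRingOfIntegers p E := ⟨x, (mem_padicRingOfIntegers_iff_padicAbs p x).2 hx⟩
  obtain ⟨y, hy⟩ := surjective_frobenius κ p (IsLocalRing.residue _ x')
  obtain ⟨y, rfl⟩ := IsLocalRing.residue_surjective y
  refine ⟨y, (mem_padicRingOfIntegers_iff_padicAbs p _).1 y.2, ?_⟩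
  rw [frobenius_def, ← map_pow, eq_comm, ← sub_eq_zero, ← map_sub,
    residue_eq_zero_iff_padicAbs_lt_one] at hy
  exact hy

theorem exists_padicAbs_sub_natCast_lt_one {y : E} (hy : padicAbs p E y ≤ 1)
    (hyp : padicAbs p E (y ^ p - y) < 1) : ∃ k < p, padicAbs p E (y - (k : ℕ)) < 1 := by
  let y' : padicRingOfIntegers p E := ⟨y, (mem_padicRingOfIntegers_iff_padicAbs p y).2 hy⟩
  have h0 : IsLocalRing.residue _ y' ^ p = IsLocalRing.residue _ y' := by
    rw [← sub_eq_zero, ← map_pow, ← map_sub, residue_eq_zero_iff_padicAbs_lt_one]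
    exact hyp
  rw [← Subfield.mem_bot_iff_pow_eq_self κ p, ← ZMod.fieldRange_castHom_eq_bot p] at h0
  obtain ⟨k, hk⟩ := h0
  refine ⟨k.val, ZMod.val_lt k, ?_⟩
  rw [← ZMod.natCast_zmod_val k, map_natCast, eq_comm, ← sub_eq_zero,
    ← map_natCast (IsLocalRing.residue _), ← map_sub, residue_eq_zero_iff_padicAbs_lt_one] at hk
  rwa [AddSubgroupClass.coe_sub, show ((k.val : padicRingOfIntegers p E) : E) = k.val from
    map_natCast (padicRingOfIntegers p E).subtype _] at hk

/-- Otherwise Frobenius fixes every residue class, and the residue field is `𝔽_p`. -/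
theorem exists_padicAbs_pow_sub_eq_one (hcard : Nat.card κ ≠ p) :
    ∃ w : E, padicAbs p E w ≤ 1 ∧ padicAbs p E (w ^ p - w) = 1 := by
  by_contra! hne
  apply hcard
  have htop : (⊥ : Subfield κ) = ⊤ := by
    refine top_unique fun x _ => ?_
    obtain ⟨x, rfl⟩ := IsLocalRing.residue_surjective x
    rw [Subfield.mem_bot_iff_pow_eq_self κ p, ← sub_eq_zero, ← map_pow, ← map_sub,
      residue_eq_zero_iff_padicAbs_lt_one]
    exact lt_of_le_of_ne ((mem_padicRingOfIntegers_iff_padicAbs p _).1 (x ^ p - x).2)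
      (hne x ((mem_padicRingOfIntegers_iff_padicAbs p _).1 x.2))
  refine Eq.trans ?_ (Subfield.card_bot κ p)
  rw [htop]
  exact (Nat.card_congr Subfield.topEquiv.toEquiv).symm

end ResidueField

/-! ### Ramification breaks of Galois extensions of degree `p`. -/

theorem padicAbs_pow_finrank_eq (p : ℕ) [Fact p.Prime] {F E : Type*} [Field F] [Field E]
    [Algebra ℚ_[p] F] [Algebra ℚ_[p] E] [Algebra F E] [IsScalarTower ℚ_[p] F E]
    [Algebra.IsAlgebraic ℚ_[p] F] [Algebra.IsAlgebraic ℚ_[p] E]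
    [FiniteDimensional F E] [IsGalois F E] (x : E) :
    padicAbs p E x ^ Module.finrank F E = padicAbs p F (Algebra.norm F x) := by
  rw [← padicAbs_algebraMap p (E := E) (Algebra.norm F x), Algebra.norm_eq_prod_automorphisms,
    map_prod]
  simp_rw [padicAbs_algEquiv]
  rw [Finset.prod_const, Finset.card_univ, ← Nat.card_eq_fintype_card, IsGalois.card_aut_eq_finrank]

theorem IsPadicUniformizer.exists_isShift {p : ℕ} [Fact p.Prime] {F E : Type*} [Field F] [Field E]
    [Algebra ℚ_[p] F] [Algebra ℚ_[p] E] [Algebra F E] [IsScalarTower ℚ_[p] F E]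
    [Algebra.IsAlgebraic ℚ_[p] E] {ϖE : E} (hE : IsPadicUniformizer p ϖE)
    (h : IsTotallyRamifiedOfPrimeDegree p F (padicAbs p E) (padicAbs p E ϖE)) {i : ℕ}
    (hi : IsRamificationBreak p F E i) :
    ∃ σ : E ≃ₐ[F] E, IsShift p (padicAbs p E) (padicAbs p E ϖE) i σ := by
  obtain ⟨⟨hi0, htop⟩, hmax⟩ := hi
  have hne : ¬ ∀ σ : E ≃ₐ[F] E, σ ∈ lowerRamificationGroup p F E (i + 1) := fun hall =>
    absurd (hmax ⟨Nat.succ_pos i, eq_top_iff.2 fun σ _ => hall σ⟩) (Nat.not_succ_le_self i)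
  push Not at hne
  obtain ⟨σ, hσ⟩ := hne
  rw [hE.mem_lowerRamificationGroup_iff] at hσ
  push Not at hσ
  exact ⟨σ, h.isShift_of_maximal (padicAbs_algEquiv p σ) hi0
    ((hE.mem_lowerRamificationGroup_iff i σ).1 (htop ▸ Subgroup.mem_top σ)) hσ⟩

section GaloisPrimeDegree

variable {p : ℕ} [Fact p.Prime] {F E : Type*} [Field F] [Field E] [Algebra ℚ_[p] F]
  [Algebra ℚ_[p] E] [Algebra F E] [IsScalarTower ℚ_[p] F E] [Algebra.IsAlgebraic ℚ_[p] F]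
  [Algebra.IsAlgebraic ℚ_[p] E] {ϖF : F} {ϖE : E}

/-- The ramification index divides `p`, as the norm of `ϖE` has absolute value `|ϖE| ^ p` and lies
in `F`. -/
theorem IsPadicUniformizer.eq_or_eq_pow (hF : IsPadicUniformizer p ϖF)
    (hE : IsPadicUniformizer p ϖE) (hc : IsCyclicOfDegree F E p) :
    padicAbs p F ϖF = padicAbs p E ϖE ∨ padicAbs p F ϖF = padicAbs p E ϖE ^ p := by
  have hp : p.Prime := Fact.out
  have := hc.isGalois
  have : FiniteDimensional F E := Module.finite_of_finrank_pos (by rw [hc.finrank_eq]; exact hp.pos)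
  have hϖF : algebraMap F E ϖF ≠ 0 := by simpa using hF.ne_zero
  obtain ⟨n, hn⟩ := hE.exists_eq _ hϖF
  rw [padicAbs_algebraMap] at hn
  have hn0 : 0 < n := by
    have := hF.lt_one
    rwa [hn, ← zpow_zero (padicAbs p E ϖE),
      zpow_lt_zpow_iff_right_of_lt_one₀ hE.pos hE.lt_one] at this
  have hnorm := padicAbs_pow_finrank_eq p (F := F) ϖE
  rw [hc.finrank_eq] at hnorm
  obtain ⟨m, hm⟩ := hF.exists_eq (Algebra.norm F ϖE)
    (by rw [Algebra.norm_ne_zero_iff]; exact hE.ne_zero)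
  rw [hm, hn, ← zpow_mul, ← zpow_natCast] at hnorm
  have heq : (p : ℤ) = n * m := zpow_right_injective₀ hE.pos hE.lt_one.ne hnorm
  obtain ⟨n, rfl⟩ := Int.eq_ofNat_of_zero_le hn0.le
  have hdvd : n ∣ p := Int.natCast_dvd_natCast.1 ⟨m, heq⟩
  rcases (Nat.dvd_prime hp).1 hdvd with rfl | rfl
  · left
    simpa using hn
  · right
    simpa using hn

theorem IsPadicUniformizer.isTotallyRamifiedOfPrimeDegree (hF : IsPadicUniformizer p ϖF)
    (hE : IsPadicUniformizer p ϖE) (hc : IsCyclicOfDegree F E p)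
    (h : padicAbs p F ϖF = padicAbs p E ϖE ^ p) :
    IsTotallyRamifiedOfPrimeDegree p F (padicAbs p E) (padicAbs p E ϖE) where
  prime := Fact.out
  nonarch := isNonarchimedean_padicAbs p
  pos := hE.pos
  lt_one := hE.lt_one
  exists_abv_eq := hE.exists_eq
  exists_abv_algebraMap_eq x hx := by
    obtain ⟨n, hn⟩ := hF.exists_eq x hx
    exact ⟨n, by rw [padicAbs_algebraMap, hn, h, zpow_mul, zpow_natCast]⟩
  exists_uniformizer := ⟨ϖE, rfl⟩
  finrank_eq := hc.finrank_eq

/-- A positive lower ramification jump of an extension of degree `p` forces it to be ramified. -/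
theorem IsPadicUniformizer.eq_pow_of_isRamificationBreak (hF : IsPadicUniformizer p ϖF)
    (hE : IsPadicUniformizer p ϖE) (hc : IsCyclicOfDegree F E p) {i : ℕ}
    (hi : IsRamificationBreak p F E i) : padicAbs p F ϖF = padicAbs p E ϖE ^ p := by
  refine (hF.eq_or_eq_pow hE hc).resolve_left fun heq => ?_
  have hp : p.Prime := Fact.out
  obtain ⟨⟨hi0, htop⟩, hmax⟩ := hi
  refine absurd (hmax ⟨Nat.succ_pos i, eq_top_iff.2 fun σ _ => ?_⟩) (Nat.not_succ_le_self i)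
  rw [hE.mem_lowerRamificationGroup_iff]
  intro x hx
  have hN := isNonarchimedean_padicAbs p (E := E)
  have hσ : ∀ x : E, padicAbs p E x ≤ 1 →
      padicAbs p E (σ x - x) ≤ padicAbs p E ϖE ^ (i + 1) :=
    (hE.mem_lowerRamificationGroup_iff i σ).1 (htop ▸ Subgroup.mem_top σ)
  have hϖ : padicAbs p E (algebraMap F E ϖF) = padicAbs p E ϖE := by
    rw [padicAbs_algebraMap, heq]
  have hϖ0 : algebraMap F E ϖF ≠ 0 := by simpa using hF.ne_zero
  have hr0 := hE.pos.le
  have hr1 := hE.lt_one.le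
  -- Here `ϖF` is also a uniformizer of `E`. In `x = y ^ p + ϖF * z` the `p`-th power and the factor
  -- `ϖF` each gain one order, so `G_i = G` would give `G_{i+1} = G`.
  obtain ⟨y, hy, hxy⟩ := exists_padicAbs_sub_pow_lt_one hx
  set z := (x - y ^ p) / algebraMap F E ϖF with hz
  have hz1 : padicAbs p E z ≤ 1 := by
    rw [hz, map_div₀, hϖ]
    exact div_le_one_of_le₀ (hE.le_of_lt_one hxy) hr0
  have hxz : x = y ^ p + algebraMap F E ϖF * z := by
    rw [hz, mul_div_cancel₀ _ hϖ0]
    ring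
  set w := σ y - y with hw
  have hw' := hσ y hy
  rw [← hw] at hw'
  have hwr : padicAbs p E w ≤ padicAbs p E ϖE :=
    hw'.trans (pow_le_of_le_one hr0 hr1 (Nat.succ_ne_zero i))
  have hw1 : padicAbs p E w ≤ 1 := hwr.trans hr1
  have hpr : padicAbs p E (p : E) ≤ padicAbs p E ϖE := hE.le_of_lt_one (padicAbs_natCast_lt_one p)
  have hbin : padicAbs p E ((y + w) ^ p - y ^ p - w ^ p) ≤
      padicAbs p E ϖE * padicAbs p E w := by
    rcases le_total (padicAbs p E w) (padicAbs p E y) with hle | hle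
    · refine (hN.abv_add_pow_prime_sub_le hp hle).trans ?_
      have := pow_le_one₀ ((padicAbs p E).nonneg y) hy (n := p - 1)
      gcongr
      exact (mul_le_of_le_one_right ((padicAbs p E).nonneg _) this).trans hpr
    · rw [show (y + w) ^ p - y ^ p - w ^ p = (w + y) ^ p - w ^ p - y ^ p by ring]
      refine (hN.abv_add_pow_prime_sub_le hp hle).trans ?_
      have := pow_le_one₀ ((padicAbs p E).nonneg w) hw1 (n := p - 1)
      gcongr
      exact (mul_le_of_le_one_right ((padicAbs p E).nonneg _) this).trans hpr
  rw [show σ x - x = ((y + w) ^ p - y ^ p - w ^ p) + w ^ p + algebraMap F E ϖF * (σ z - z) by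
    conv_lhs => rw [hxz]
    rw [map_add, map_mul, map_pow, AlgEquiv.commutes, hw, add_sub_cancel]
    ring, pow_succ']
  refine hN.abv_add_le (hN.abv_add_le (hbin.trans (by gcongr)) ?_) ?_
  · rw [map_pow]
    calc padicAbs p E w ^ p ≤ padicAbs p E w ^ 2 :=
          pow_le_pow_of_le_one ((padicAbs p E).nonneg _) hw1 hp.two_le
      _ = padicAbs p E w * padicAbs p E w := sq _
      _ ≤ _ := by gcongr
  · rw [map_mul, hϖ]
    gcongr
    exact hσ z hz1

/-- An element of pole order `s` prime to `p` that all `σ ≠ 1` move by units determines the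
ramification break. -/
theorem IsPadicUniformizer.isRamificationBreak (hF : IsPadicUniformizer p ϖF)
    (hE : IsPadicUniformizer p ϖE) (hc : IsCyclicOfDegree F E p) {s : ℕ} (hs : 0 < s)
    (hps : ¬ p ∣ s) {γ : E} (hγ : padicAbs p E γ ^ p = padicAbs p F ϖF ^ (-s : ℤ))
    (hσγ : ∀ σ : E ≃ₐ[F] E, σ ≠ 1 → padicAbs p E (σ γ - γ) = 1) :
    IsRamificationBreak p F E s := by
  have hp : p.Prime := Fact.out
  have hps' : ¬ (p : ℤ) ∣ -(s : ℤ) := by rwa [Int.dvd_neg, Int.natCast_dvd_natCast]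
  have hγ0 : γ ≠ 0 := by
    rintro rfl
    rw [map_zero, zero_pow hp.ne_zero] at hγ
    exact (zpow_pos hF.pos _).ne hγ
  have hram : padicAbs p F ϖF = padicAbs p E ϖE ^ p := by
    -- With equal value groups, the hypothesis on `γ` would make `p` divide `s`.
    refine (hF.eq_or_eq_pow hE hc).resolve_left fun heq => hps' ?_
    obtain ⟨m, hm⟩ := hE.exists_eq γ hγ0
    rw [hm, heq, ← zpow_natCast, ← zpow_mul] at hγ
    exact ⟨m, by rw [mul_comm, zpow_right_injective₀ hE.pos hE.lt_one.ne hγ]⟩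
  have h := hF.isTotallyRamifiedOfPrimeDegree hE hc hram
  have hγ' : padicAbs p E γ = padicAbs p E ϖE ^ (-s : ℤ) := by
    refine (pow_left_inj₀ ((padicAbs p E).nonneg _) (zpow_pos hE.pos _).le hp.ne_zero).1 ?_
    rw [hγ, hram, ← zpow_natCast, ← zpow_natCast, ← zpow_mul, ← zpow_mul, mul_comm]
  have hone : padicAbs p E ϖE ^ s * padicAbs p E γ = 1 := by
    rw [hγ', ← zpow_natCast, ← h.zpow_add, add_neg_cancel, zpow_zero]
  refine ⟨⟨hs, eq_top_iff.2 fun σ _ => ?_⟩, fun n ⟨_, hn⟩ => not_lt.1 fun hsn => ?_⟩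
  · rw [hE.mem_lowerRamificationGroup_iff]
    rcases eq_or_ne σ 1 with rfl | hσ1
    · intro x _
      simp [pow_nonneg hE.pos.le]
    · intro x hx
      exact h.abv_shift_le_of_generator (padicAbs_algEquiv p σ) hγ' hps'
        (by rw [hσγ σ hσ1, hone]) hx
  · have := hc.isGalois
    have : FiniteDimensional F E :=
      Module.finite_of_finrank_pos (by rw [hc.finrank_eq]; exact hp.pos)
    have : Nontrivial (E ≃ₐ[F] E) := by
      rw [← Finite.one_lt_card_iff_nontrivial, IsGalois.card_aut_eq_finrank, hc.finrank_eq]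
      exact hp.one_lt
    obtain ⟨σ, hσ1⟩ := exists_ne (1 : E ≃ₐ[F] E)
    have hle := h.abv_shift_le (padicAbs_algEquiv p σ)
      ((hE.mem_lowerRamificationGroup_iff n σ).1 (hn ▸ Subgroup.mem_top σ)) γ
    rw [hσγ σ hσ1, ← hone] at hle
    have hlt : padicAbs p E ϖE ^ n < padicAbs p E ϖE ^ s :=
      pow_lt_pow_right_of_lt_one₀ hE.pos hE.lt_one hsn
    exact absurd (le_of_mul_le_mul_right hle ((padicAbs p E).pos hγ0)) (not_le.2 hlt)

end GaloisPrimeDegree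

/-! ### Artin–Schreier equations with a moderate pole. -/

theorem natDegree_X_pow_sub_X_sub_C {F : Type*} [Field F] {n : ℕ} (hn : 1 < n) (a : F) :
    (X ^ n - X - C a : F[X]).natDegree = n := by
  rw [natDegree_sub_C, natDegree_sub_eq_left_of_natDegree_lt] <;> simp [hn]

section ArtinSchreierRoots

variable {L : Type*} [Field L] {N : AbsoluteValue L ℝ} {p : ℕ}

theorem IsNonarchimedean.abv_pow_eq_of_one_lt (hN : IsNonarchimedean N) (hp : p.Prime) {x y : L}
    (hy : N y ≤ N x) (h : 1 < N (x ^ p - y)) : 1 < N x ∧ N x ^ p = N (x ^ p - y) := by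
  have h1 : 1 < N x := by
    by_contra! hle
    refine absurd h (not_lt.2 (hN.abv_sub_le ?_ (hy.trans hle)))
    rw [map_pow]
    exact pow_le_one₀ (N.nonneg _) hle
  refine ⟨h1, ?_⟩
  have hlt : N y < N (x ^ p) := by
    rw [map_pow]
    exact hy.trans_lt (lt_self_pow₀ h1 hp.one_lt)
  rw [sub_eq_add_neg, hN.add_eq_left_of_lt (by rwa [N.map_neg]), map_pow]

/-- Distinct roots of an Artin-Schreier polynomial with a moderate pole differ by units that are
fixed by the Frobenius modulo the maximal ideal. -/
theorem IsNonarchimedean.abv_sub_root_eq_one (hN : IsNonarchimedean N) (hp : p.Prime) {α β : L}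
    (hα : N (p : L) * N α ^ (p - 1) < 1) (hβα : N β ≤ N α) (heq : β ^ p - β = α ^ p - α)
    (hne : β ≠ α) : N (β - α) = 1 ∧ N ((β - α) ^ p - (β - α)) < 1 := by
  set y := β - α with hy
  have hy0 : 0 < N y := N.pos (sub_ne_zero.2 hne)
  have hlt : N (y ^ p - y) < N y := by
    rw [show y ^ p - y = -((α + y) ^ p - α ^ p - y ^ p) by
      rw [hy, add_sub_cancel]
      linear_combination heq, N.map_neg]
    refine (hN.abv_add_pow_prime_sub_le hp (hN.abv_sub_le hβα le_rfl)).trans_lt ?_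
    exact mul_lt_of_lt_one_left hy0 hα
  have h1 := hN.abv_eq_of_sub_lt hlt
  have hy1 : N y = 1 := by
    rw [map_pow, ← Nat.sub_add_cancel hp.one_le, pow_succ] at h1
    have h2 := mul_right_cancel₀ hy0.ne' (h1.trans (one_mul _).symm)
    exact (pow_eq_one_iff_of_nonneg hy0.le (by have := hp.two_le; omega)).1 h2
  exact ⟨hy1, hy1 ▸ hlt⟩

end ArtinSchreierRoots

theorem isGalois_of_isAlgClosure_padic (p : ℕ) [Fact p.Prime] (F Ω : Type*) [Field F]
    [Algebra ℚ_[p] F] [Field Ω] [Algebra ℚ_[p] Ω] [IsAlgClosure ℚ_[p] Ω] [Algebra F Ω]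
    [IsScalarTower ℚ_[p] F Ω] : IsGalois F Ω := by
  have : Algebra.IsAlgebraic ℚ_[p] Ω := IsAlgClosure.isAlgebraic
  have : CharZero F := charZero_of_injective_algebraMap (algebraMap ℚ_[p] F).injective
  have : Algebra.IsAlgebraic F Ω := Algebra.IsAlgebraic.tower_top (K := ℚ_[p]) F
  have : IsAlgClosed Ω := IsAlgClosure.isAlgClosed ℚ_[p]
  have : IsAlgClosure F Ω := ⟨inferInstance, inferInstance⟩
  have := IsAlgClosure.normal F Ω
  exact ⟨⟩

section ArtinSchreier

variable {p : ℕ} [Fact p.Prime] {F Ω : Type*} [Field F] [Algebra ℚ_[p] F]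
  [Field Ω] [Algebra ℚ_[p] Ω] [IsAlgClosure ℚ_[p] Ω] [Algebra.IsAlgebraic ℚ_[p] Ω] [Algebra F Ω]
  [IsScalarTower ℚ_[p] F Ω]

open IntermediateField

/-- A Krasner argument: an automorphism fixing `α` moves `β` by less than a unit, while distinct
roots differ by units. -/
theorem mem_adjoin_of_artinSchreier_conjugate {α β : Ω}
    (hα : padicAbs p Ω (p : Ω) * padicAbs p Ω α ^ (p - 1) < 1)
    (hβα : padicAbs p Ω β = padicAbs p Ω α) (heq : β ^ p - β = α ^ p - α) : β ∈ F⟮α⟯ := by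
  have hp : p.Prime := Fact.out
  have hN := isNonarchimedean_padicAbs p (E := Ω)
  rcases eq_or_ne β α with rfl | hne
  · exact mem_adjoin_simple_self F β
  obtain ⟨h1, h2⟩ := hN.abv_sub_root_eq_one hp hα hβα.le heq hne
  obtain ⟨k, -, hk⟩ := exists_padicAbs_sub_natCast_lt_one h1.le h2
  have : IsGalois F Ω := isGalois_of_isAlgClosure_padic p F Ω
  rw [← InfiniteGalois.fixedField_fixingSubgroup F⟮α⟯, mem_fixedField_iff]
  intro τ hτ
  have hτα : τ α = α := hτ ⟨α, mem_adjoin_simple_self F α⟩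
  by_contra hne'
  have hτβ : (τ β) ^ p - τ β = β ^ p - β := by
    rw [heq, ← map_pow, ← map_sub, heq, map_sub, map_pow, hτα]
  refine absurd (hN.abv_sub_root_eq_one hp (hβα ▸ hα) (padicAbs_algEquiv p τ β).le hτβ hne').1
    (ne_of_lt ?_)
  -- `τ` fixes both `α` and the integer `k`, and `β - α - k` is small.
  rw [show τ β - β = τ (β - α - (k : ℕ)) - (β - α - (k : ℕ)) by
    rw [map_sub, map_sub, map_natCast, hτα]; ring]
  exact hN.abv_sub_lt (by rwa [padicAbs_algEquiv]) hk

/-- Artin-Schreier equations with a moderate pole generate cyclic extensions of degree `p`, with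
ramification break given by a reduced pole order prime to `p`. -/
theorem isCyclicOfDegree_and_isRamificationBreak_of_artinSchreier [FiniteDimensional ℚ_[p] F]
    {ϖ : F} (hϖ : IsPadicUniformizer p ϖ) {α : Ω} {a b : F}
    (ha : α ^ p - α = algebraMap F Ω a) (hα1 : 1 < padicAbs p Ω α)
    (hα : padicAbs p Ω (p : Ω) * padicAbs p Ω α ^ (p - 1) < 1) {s : ℕ} (hs : 0 < s)
    (hps : ¬ p ∣ s)
    (hγ : padicAbs p Ω (α - algebraMap F Ω b) ^ p = padicAbs p F ϖ ^ (-s : ℤ)) :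
    IsCyclicOfDegree F F⟮α⟯ p ∧ IsRamificationBreak p F F⟮α⟯ s := by
  have hp : p.Prime := Fact.out
  have hN := isNonarchimedean_padicAbs p (E := Ω)
  have hgal : IsGalois F Ω := isGalois_of_isAlgClosure_padic p F Ω
  have hconj : ∀ β : Ω, β ^ p - β = α ^ p - α → padicAbs p Ω β = padicAbs p Ω α := by
    intro β hβ
    have h1 : 1 < padicAbs p Ω (α ^ p - α) := by
      rw [sub_eq_add_neg, hN.add_eq_left_of_lt, map_pow]
      · exact one_lt_pow₀ hα1 hp.ne_zero
      · rw [map_pow, AbsoluteValue.map_neg]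
        exact lt_self_pow₀ hα1 hp.one_lt
    refine (pow_left_inj₀ ((padicAbs p Ω).nonneg _) ((padicAbs p Ω).nonneg _) hp.ne_zero).1 ?_
    rw [(hN.abv_pow_eq_of_one_lt hp le_rfl h1).2,
      (hN.abv_pow_eq_of_one_lt hp le_rfl (hβ ▸ h1)).2, hβ]
  have hint : IsIntegral F α := Algebra.IsIntegral.isIntegral α
  have : FiniteDimensional F F⟮α⟯ := adjoin.finiteDimensional hint
  have : Normal F F⟮α⟯ := by
    rw [normal_iff_forall_map_le']
    intro σ
    rw [adjoin_map, Set.image_singleton, adjoin_simple_le_iff]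
    have hσ : (σ α) ^ p - σ α = α ^ p - α := by
      rw [← map_pow, ← map_sub, ha, AlgEquiv.commutes]
    exact mem_adjoin_of_artinSchreier_conjugate hα (hconj _ hσ) hσ
  have : IsGalois F F⟮α⟯ := ⟨⟩
  set γ : F⟮α⟯ := AdjoinSimple.gen F α - algebraMap F F⟮α⟯ b with hγdef
  have hγ' : padicAbs p F⟮α⟯ γ ^ p = padicAbs p F ϖ ^ (-s : ℤ) := by
    rw [← hγ, ← padicAbs_algebraMap p (E := Ω) γ]
    rfl
  have hγ0 : γ ≠ 0 := by
    intro h0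
    rw [h0, map_zero, zero_pow hp.ne_zero] at hγ'
    exact (zpow_pos hϖ.pos _).ne hγ'
  have hfin : Module.finrank F F⟮α⟯ = p := by
    refine le_antisymm ?_ (Nat.le_of_dvd Module.finrank_pos ?_)
    · rw [adjoin.finrank hint]
      have hdeg := natDegree_X_pow_sub_X_sub_C hp.one_lt a
      rw [← hdeg]
      refine natDegree_le_of_dvd (minpoly.dvd F α ?_) ?_
      · simp [ha]
      · intro h0
        rw [h0, natDegree_zero] at hdeg
        exact hp.ne_zero hdeg.symm
    -- The norm of `γ` has integral valuation in `F`, so `p` divides `s` times the degree, hence the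
    -- degree.
    · obtain ⟨m, hm⟩ := hϖ.exists_eq (Algebra.norm F γ) (Algebra.norm_ne_zero_iff.2 hγ0)
      have hd := padicAbs_pow_finrank_eq p (F := F) γ
      have hd' : (padicAbs p F⟮α⟯ γ ^ p) ^ Module.finrank F F⟮α⟯ = padicAbs p F ϖ ^ (m * p) := by
        rw [← pow_mul, mul_comm, pow_mul, hd, hm, zpow_mul, zpow_natCast]
      rw [hγ', ← zpow_natCast, ← zpow_mul] at hd'
      have heq := zpow_right_injective₀ hϖ.pos hϖ.lt_one.ne hd'
      have hdvd : (p : ℤ) ∣ (s * Module.finrank F F⟮α⟯ : ℕ) :=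
        ⟨-m, by push_cast; linear_combination -heq⟩
      exact (hp.dvd_mul.1 (Int.natCast_dvd_natCast.1 hdvd)).resolve_left hps
  have hc : IsCyclicOfDegree F F⟮α⟯ p :=
    ⟨inferInstance, isCyclic_of_prime_card (p := p)
      ((IsGalois.card_aut_eq_finrank F F⟮α⟯).trans hfin), hfin⟩
  have : FiniteDimensional ℚ_[p] F⟮α⟯ := FiniteDimensional.trans ℚ_[p] F F⟮α⟯
  obtain ⟨ϖE, hϖE⟩ := exists_isPadicUniformizer p (E := F⟮α⟯)
  refine ⟨hc, hϖ.isRamificationBreak hϖE hc hs hps hγ' fun σ hσ => ?_⟩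
  have hne : σ (AdjoinSimple.gen F α) ≠ AdjoinSimple.gen F α := by
    intro h0
    refine hσ (AlgEquiv.coe_toAlgHom_injective ((adjoin.powerBasis hint).algHom_ext ?_))
    simpa using h0
  have heq : ((σ (AdjoinSimple.gen F α) : F⟮α⟯) : Ω) ^ p - (σ (AdjoinSimple.gen F α) : F⟮α⟯) =
      α ^ p - α := by
    have hgen : (AdjoinSimple.gen F α) ^ p - AdjoinSimple.gen F α = algebraMap F F⟮α⟯ a :=
      Subtype.ext ha
    have := congrArg σ hgen
    rw [map_sub, map_pow, AlgEquiv.commutes] at this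
    rw [ha]
    exact congrArg (Subtype.val) this
  rw [hγdef, map_sub σ, AlgEquiv.commutes, sub_sub_sub_cancel_right,
    ← padicAbs_algebraMap p (E := Ω)]
  exact (hN.abv_sub_root_eq_one hp hα (hconj _ heq).le heq
    fun h0 => hne (Subtype.ext h0)).1

end ArtinSchreier

/-! ### The compositum with `L` and the choice among the three cases. -/

open IntermediateField in
theorem extendScalars_sup_adjoin_simple {K Ω : Type*} [Field K] [Field Ω] [Algebra K Ω]
    (L : IntermediateField K Ω) (α : Ω) :
    extendScalars (le_sup_left : L ≤ L ⊔ K⟮α⟯) = L⟮α⟯ := by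
  apply restrictScalars_injective K
  rw [extendScalars_restrictScalars, restrictScalars_adjoin_eq_sup]

section ArtinSchreierCompositum

variable {p : ℕ} [Fact p.Prime]
    {K : Type*} [Field K] [Algebra ℚ_[p] K] [FiniteDimensional ℚ_[p] K]
    {Ω : Type*} [Field Ω] [Algebra ℚ_[p] Ω] [IsAlgClosure ℚ_[p] Ω] [Algebra K Ω]
    [IsScalarTower ℚ_[p] K Ω]

open IntermediateField in
/-- If `a - b ^ p + b` has pole order `s` in `L`, the Artin-Schreier equation of `a` defines an
extension of `K` whose compositum with `L` has break `s` over `L`. -/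
theorem exists_extension_of_reduction {L : IntermediateField K Ω} (hL : IsCyclicOfDegree K L p)
    {ϖK : K} (hϖK : IsPadicUniformizer p ϖK) {ϖL : L} (hϖL : IsPadicUniformizer p ϖL)
    (hram : padicAbs p K ϖK = padicAbs p L ϖL ^ p) {j s : ℕ} (hj : 0 < j) (hs : 0 < s)
    (hpj : ¬ p ∣ j) (hps : ¬ p ∣ s) (hsj : s < p * j)
    (hje : p * j < p * absRamificationIndex p K + j) {a : K} {b : L}
    (hb : padicAbs p L b = padicAbs p L ϖL ^ (-j : ℤ))
    (hc : padicAbs p L (algebraMap K L a - b ^ p + b) = padicAbs p L ϖL ^ (-s : ℤ)) :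
    ∃ L' : IntermediateField K Ω,
      IsCyclicOfDegree K L' p ∧ IsRamificationBreak p K L' j ∧
      IsCyclicOfDegree L (extendScalars (le_sup_left : L ≤ L ⊔ L')) p ∧
      IsRamificationBreak p L (extendScalars (le_sup_left : L ≤ L ⊔ L')) s := by
  have hp : p.Prime := Fact.out
  have hΩ : Algebra.IsAlgebraic ℚ_[p] Ω := IsAlgClosure.isAlgebraic
  have : IsAlgClosed Ω := IsAlgClosure.isAlgClosed ℚ_[p]
  have : FiniteDimensional K L :=
    Module.finite_of_finrank_pos (by rw [hL.finrank_eq]; exact hp.pos)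
  have : FiniteDimensional ℚ_[p] L := FiniteDimensional.trans ℚ_[p] K L
  have h := hϖK.isTotallyRamifiedOfPrimeDegree hϖL hL hram
  have hN := isNonarchimedean_padicAbs p (E := Ω)
  have hpe : padicAbs p L (p : L) = padicAbs p L ϖL ^ (p * absRamificationIndex p K : ℤ) := by
    rw [← map_natCast (algebraMap K L) p, padicAbs_algebraMap, hϖK.padicAbs_natCast_eq, hram,
      ← pow_mul, ← zpow_natCast]
    push_cast
    rfl
  have hpb := h.abv_natCast_mul_pow_lt_one hpe hje hb
  have haL : padicAbs p L (algebraMap K L a) = padicAbs p L ϖL ^ (-(p * j : ℤ)) := by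
    have hbp : padicAbs p L (b ^ p) = padicAbs p L ϖL ^ (-(p * j : ℤ)) := by
      rw [map_pow, hb, ← zpow_natCast, ← zpow_mul]
      congr 1
      ring
    rw [← hbp]
    refine h.nonarch.abv_eq_of_sub_lt ?_
    rw [show algebraMap K L a - b ^ p = (algebraMap K L a - b ^ p + b) - b by ring]
    refine h.nonarch.abv_sub_lt ?_ ?_
    · rw [hc, hbp, h.zpow_lt]
      exact_mod_cast neg_lt_neg (Int.ofNat_lt.2 hsj)
    · rw [hb, hbp, h.zpow_lt, neg_lt_neg_iff]
      exact_mod_cast (lt_mul_iff_one_lt_left hj).2 hp.one_lt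
  obtain ⟨α, hα⟩ := IsAlgClosed.exists_aeval_eq_zero Ω (X ^ p - X - C a)
    fun h0 => hp.ne_zero <| by
      rw [← natDegree_X_pow_sub_X_sub_C hp.one_lt a, natDegree_eq_zero_iff_degree_le_zero.2 h0.le]
  have hα : α ^ p - α = algebraMap K Ω a := by
    simpa [sub_eq_zero] using hα
  have haΩ : padicAbs p Ω (algebraMap K Ω a) = padicAbs p L ϖL ^ (-(p * j : ℤ)) := by
    rw [← haL, padicAbs_algebraMap, padicAbs_algebraMap]
  have h1a : 1 < padicAbs p Ω (α ^ p - α) := by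
    rw [hα, haΩ, ← zpow_zero (padicAbs p L ϖL), h.zpow_lt, Left.neg_neg_iff]
    exact_mod_cast Nat.mul_pos hp.pos hj
  obtain ⟨hα1, hαp⟩ := hN.abv_pow_eq_of_one_lt hp le_rfl h1a
  rw [hα, haΩ] at hαp
  have hbΩ : padicAbs p Ω (algebraMap L Ω b) = padicAbs p L ϖL ^ (-j : ℤ) := by
    rw [padicAbs_algebraMap, hb]
  have hαN : padicAbs p Ω α = padicAbs p L b := by
    refine (pow_left_inj₀ ((padicAbs p Ω).nonneg _) ((padicAbs p L).nonneg _) hp.ne_zero).1 ?_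
    rw [hαp, hb, ← zpow_natCast, ← zpow_mul]
    congr 1
    ring
  have hpα : padicAbs p Ω (p : Ω) * padicAbs p Ω α ^ (p - 1) < 1 := by
    rwa [hαN, ← map_natCast (algebraMap L Ω) p, padicAbs_algebraMap]
  obtain ⟨h1, h2⟩ := isCyclicOfDegree_and_isRamificationBreak_of_artinSchreier hϖK (b := 0) hα hα1
    hpα hj hpj (by
      rw [map_zero, sub_zero, hαp, hram, ← zpow_natCast, ← zpow_mul]
      congr 1
      ring)
  set γ := α - algebraMap L Ω b with hγ
  have hγb : padicAbs p Ω γ ≤ padicAbs p Ω (algebraMap L Ω b) :=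
    hN.abv_sub_le (by rw [hαN, padicAbs_algebraMap]) le_rfl
  -- Expanding `α = b + γ` shows that `γ ^ p` equals `c` up to terms no larger than `γ`; as `c` has
  -- a pole, `|γ| ^ p = |c|`.
  have hcΩ : γ ^ p - (γ - ((algebraMap L Ω b + γ) ^ p - algebraMap L Ω b ^ p - γ ^ p)) =
      algebraMap L Ω (algebraMap K L a - b ^ p + b) := by
    rw [map_add, map_sub, map_pow, ← IsScalarTower.algebraMap_apply, ← hα, hγ, add_sub_cancel]
    ring
  have hcN : padicAbs p Ω
      (γ ^ p - (γ - ((algebraMap L Ω b + γ) ^ p - algebraMap L Ω b ^ p - γ ^ p))) =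
      padicAbs p L ϖL ^ (-s : ℤ) := by
    rw [hcΩ, padicAbs_algebraMap, hc]
  have hγp := (hN.abv_pow_eq_of_one_lt hp (hN.abv_sub_le le_rfl <|
    (hN.abv_add_pow_prime_sub_le hp hγb).trans <|
      mul_le_of_le_one_left ((padicAbs p Ω).nonneg _) (by
        rw [padicAbs_algebraMap, ← hαN]
        exact hpα.le)) (by
      rw [hcN, ← zpow_zero (padicAbs p L ϖL), h.zpow_lt, Left.neg_neg_iff]
      exact_mod_cast hs)).2
  rw [hcN] at hγp
  obtain ⟨h3, h4⟩ := isCyclicOfDegree_and_isRamificationBreak_of_artinSchreier (F := L) hϖL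
    (hα.trans (IsScalarTower.algebraMap_apply K L Ω a)) hα1 hpα hs hps hγp
  refine ⟨K⟮α⟯, h1, h2, ?_⟩
  rw [extendScalars_sup_adjoin_simple]
  exact ⟨h3, h4⟩

end ArtinSchreierCompositum

theorem lemma3p2 (p : ℕ) [Fact p.Prime]
    (K : Type*) [Field K] [Algebra ℚ_[p] K] [FiniteDimensional ℚ_[p] K]
    (Ω : Type*) [Field Ω] [Algebra ℚ_[p] Ω] [IsAlgClosure ℚ_[p] Ω] [Algebra K Ω]
    [IsScalarTower ℚ_[p] K Ω]
    (L : IntermediateField K Ω) (hL : IsCyclicOfDegree K L p)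
    (i : ℕ) (hi : IsRamificationBreak p K L i)
    (j s : ℕ) (hj : 0 < j) (hs : 0 < s) (hpj : ¬ p ∣ j) (hps : ¬ p ∣ s)
    (h_le : s ≤ i → s ≤ j)
    (h_gt : i < s → (i : ℝ) + ((s : ℝ) - i) / p ≤ j)
    (hje : (j : ℝ) ≤ p * absRamificationIndex p K / (p - 1))
    (h_ne : i ≠ j → (s : ℝ) = herbrandFunction p i j)
    (h_res : i = j → s = i →
      Nat.card (IsLocalRing.ResidueField (padicRingOfIntegers p K)) ≠ p) :
    ∃ L' : IntermediateField K Ω,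
      IsCyclicOfDegree K L' p ∧ IsRamificationBreak p K L' j ∧
      IsCyclicOfDegree L (IntermediateField.extendScalars (le_sup_left : L ≤ L ⊔ L')) p ∧
      IsRamificationBreak p L (IntermediateField.extendScalars (le_sup_left : L ≤ L ⊔ L')) s := by
  have hp : p.Prime := Fact.out
  have hp2 : (2 : ℝ) ≤ p := by exact_mod_cast hp.two_le
  have : FiniteDimensional K L :=
    Module.finite_of_finrank_pos (by rw [hL.finrank_eq]; exact hp.pos)
  have : FiniteDimensional ℚ_[p] L := FiniteDimensional.trans ℚ_[p] K L
  obtain ⟨ϖK, hϖK⟩ := exists_isPadicUniformizer p (E := K)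
  obtain ⟨ϖL, hϖL⟩ := exists_isPadicUniformizer p (E := L)
  have hram := hϖK.eq_pow_of_isRamificationBreak hϖL hL hi
  have h := hϖK.isTotallyRamifiedOfPrimeDegree hϖL hL hram
  obtain ⟨σ, hσ⟩ := hϖL.exists_isShift h hi
  set e := absRamificationIndex p K
  have hpe : padicAbs p L (p : L) = padicAbs p L ϖL ^ (p * e : ℤ) := by
    rw [← map_natCast (algebraMap K L) p, padicAbs_algebraMap, hϖK.padicAbs_natCast_eq, hram,
      ← pow_mul, ← zpow_natCast]
    push_cast
    rfl
  -- Equality in the bound on `j` would force `p ∣ j`.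
  have hpj' : p * j < p * e + j := by
    refine lt_of_le_of_ne ?_ fun heq => hpj ((Nat.dvd_add_right (dvd_mul_right p e)).1
      (heq ▸ dvd_mul_right p j))
    rw [le_div_iff₀ (by linarith)] at hje
    have : (p * j : ℝ) ≤ p * e + j := by linarith
    exact_mod_cast this
  have hp1j : 2 * j ≤ p * j := Nat.mul_le_mul_right j hp.two_le
  suffices s < p * j ∧ ∃ (a : K) (b : L), padicAbs p L b = padicAbs p L ϖL ^ (-j : ℤ) ∧
      padicAbs p L (algebraMap K L a - b ^ p + b) = padicAbs p L ϖL ^ (-s : ℤ) by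
    obtain ⟨hsj, a, b, hb, hc⟩ := this
    exact exists_extension_of_reduction hL hϖK hϖL hram hj hs hpj hps hsj hpj' hb hc
  rcases lt_trichotomy j i with hji | rfl | hij
  · have hsj : s = j := by
      have := h_ne hji.ne'
      rw [herbrandFunction, if_pos (by exact_mod_cast hji.le)] at this
      exact_mod_cast this
    subst hsj
    exact ⟨by omega, h.exists_reduction_of_lt hσ hpe hpj (by exact_mod_cast hpj') hji⟩
  -- For `i = j`, the bound `i + (s - i) / p ≤ j` excludes `s > i`.
  · have hsj : s ≤ j := by
      by_contra! hlt
      have := h_gt hlt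
      have hlt' : (j : ℝ) < s := by exact_mod_cast hlt
      have : 0 < ((s : ℝ) - j) / p := div_pos (by linarith) (by linarith)
      linarith
    refine ⟨by omega, ?_⟩
    rcases hsj.lt_or_eq with hlt | rfl
    · exact h.exists_reduction_of_eq hσ hpe (padicAbs_natCast_lt_one p) hpj hpj' hps hlt
    · obtain ⟨w, hw, hw'⟩ := exists_padicAbs_pow_sub_eq_one (h_res rfl rfl)
      exact h.exists_reduction_of_residue hσ hpe hpj (by exact_mod_cast hpj') (w := w)
        (by rwa [padicAbs_algebraMap]) (by rwa [padicAbs_algebraMap])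
  · have hsj := h_ne hij.ne
    rw [herbrandFunction, if_neg (by exact_mod_cast hij.not_ge)] at hsj
    have hsj' : (s : ℤ) = p * j - (p - 1) * i := by exact_mod_cast hsj
    have hi0 := hσ.pos
    refine ⟨?_, h.exists_reduction_of_gt hσ hpe hpj ?_ hij hsj'⟩
    · have hp2' : (2 : ℤ) ≤ p := by exact_mod_cast hp.two_le
      zify at hi0 ⊢
      nlinarith
    · have hp2' : (2 : ℤ) ≤ p := by exact_mod_cast hp.two_le
      zify at hij hpj'
      nlinarith
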